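/- Let $\hbar,M,L>0$, $\nu\ge 0$, $\beta\ge 0$, $\varepsilon_0=\hbar^2\pi^2/(2ML^2)$, and consider on $L^2(0,L)$ the Pöschl–Teller Hamiltonian $$\mathbf H_{\nu,\beta}=-\frac{\hbar^2}{2M}\frac{d^2}{dx^2}+\varepsilon_0\Big(\frac{\nu(\nu+1)}{\sin^2\frac{\pi x}{L}}-2\beta\cot\frac{\pi x}{L}\Big)$$ with Dirichlet boundary conditions. For $n\in\mathbb N=\{0,1,\dots\}$ put $b_n=\frac{\beta}{n+\nu+1}$, $a_n=-(n+\nu+1)+ib_n$, $$E_n=\varepsilon_0\Big((n+\nu+1)^2-\frac{\beta^2}{(n+\nu+1)^2}\Big),$$ $$\phi_n(x)=K_n\sin^{\nu+n+1}\tfrac{\pi x}{L}\;e^{-\frac{\beta\pi x}{L(\nu+n+1)}}\,P_n^{(a_n,\bar a_n)}\big(i\cot\tfrac{\pi x}{L}\big),$$ $$K_n=2^{n+\nu+1}L^{-1/2}\,\mathcal T(n)\,\mathcal O(n)^{-1/2}\,e^{\frac{\beta\pi}{2(n+\nu+1)}},\qquad \mathcal T(n)=\frac{n!}{|(-n-\nu+ib_n)_n|},$$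 $$\mathcal O(n)=\sum_{k=0}^n\sum_{s=0}^n\frac{(-n)_k(-2\nu-n-1)_k}{(-\nu-n-ib_n)_k\,k!\,\Gamma(n+\nu+2-k+ib_n)}\cdot\frac{(-n)_s(-2\nu-n-1)_s\,\Gamma(2n+2\nu-s-k+3)}{(-\nu-n+ib_n)_s\,s!\,\Gamma(n+\nu+2-s-ib_n)},$$ where $(c)_k$ is the rising factorial and $P_n^{(a,b)}$ the Jacobi polynomial. Then $\mathcal O(n)$ is real and positive, and $\phi_n$ is a normalized eigenfunction of $\mathbf H_{\nu,\beta}$ with eigenvalue $E_n$. Define recursively $E_n^{(0)}=E_n$, $\phi_n^{(0)}=\phi_n$, $\mathbf H^{(0)}=\mathbf H_{\nu,\beta}$ and, for $m\ge 0$, $$W_m=-\hbar\frac{(\phi_0^{(m)})'}{\phi_0^{(m)}},\quad A_m=\hbar\frac{d}{dx}+W_m,\quad A_m^\dagger=-\hbar\frac{d}{dx}+W_m,$$ $$\mathbf H^{(m+1)}=\frac1{2M}A_mA_m^\dagger+E_0^{(m)},\quad V_{m+1}=\frac1{2M}\big(W_m^2+\hbar W_m'\big)+E_0^{(m)},\quad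 E_n^{(m+1)}=E_{n+1}^{(m)},$$ $\phi_n^{(m+1)}$ being the positive multiple of $A_m\phi_{n+1}^{(m)}$ that has norm $1$ in $L^2(0,L)$; all $\mathbf H^{(m)}$ are taken with Dirichlet boundary conditions, and $V_0$ is the potential of $\mathbf H_{\nu,\beta}$. This hierarchy is well defined: $\phi_0^{(m)}$ has no zero in $(0,L)$, and $\mathbf H^{(m)}=\frac1{2M}A_m^\dagger A_m+E_0^{(m)}=-\frac{\hbar^2}{2M}\frac{d^2}{dx^2}+V_m$ for all $m\ge0$. For all $m,n\ge 0$, $\phi_n^{(m+1)}$ is a normalized eigenfunction of $\mathbf H^{(m+1)}$ with eigenvalue $E_n^{(m+1)}$, where $$E_n^{(m+1)}=\varepsilon_0\Big((n+m+\nu+2)^2-\frac{\beta^2}{(n+m+\nu+2)^2}\Big),$$ $$\phi_n^{(m+1)}=\frac{A_mA_{m-1}\cdots A_1A_0\,\phi_{n+m+1}}{\sqrt{(2M)^{m+1}\prod_{k=0}^m(E_{n+m+1}-E_k)}},$$ with $E_k<E_{n+m+1}$ for $0\le k\le m$. The $E_n^{(m+1)}$, $n\ge0$, are the only eigenvalues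 of $\mathbf H^{(m+1)}$, and every eigenfunction is a multiple of some $\phi_n^{(m+1)}$. In particular, for $m=0$: $E_n^{(1)}=\varepsilon_0\big((n+\nu+2)^2-\frac{\beta^2}{(n+\nu+2)^2}\big)$, $$\phi_n^{(1)}(x)=\frac{2^{n+\nu+2}e^{\frac{\beta\pi}{2(n+\nu+2)}}\mathcal T(n+1)}{\sqrt{2ML(n+1)\,\mathcal O(n+1)\,\overline\Delta_n}}\Big[\Big(\frac{2M(n+1)^2\overline\Delta_n}{n+2\nu+3}\Big)^{1/2}\cos\big(\tfrac{\pi x}{L}-\alpha_n\big)P_{n+1}^{(a_{n+1},\bar a_{n+1})}\big(i\cot\tfrac{\pi x}{L}\big)+\frac{i\pi\hbar(n+2\nu+2)}{2L\sin\frac{\pi x}{L}}P_n^{(a_{n+1}+1,\bar a_{n+1}+1)}\big(i\cot\tfrac{\pi x}{L}\big)\Big]\sin^{\nu+n+1}\tfrac{\pi x}{L}\,e^{-\frac{\beta\pi x}{L(\nu+n+2)}},$$ $$W_1(x)=-\frac{\hbar\pi}{L}\Big((\nu+2)\cot\frac{\pi x}{L}-\frac{\beta}{\nu+2}\Big),\qquad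 V_1(x)=\varepsilon_0\Big(\frac{(\nu+1)(\nu+2)}{\sin^2\frac{\pi x}{L}}-2\beta\cot\frac{\pi x}{L}\Big)$$ for $0<x<L$, where $\alpha_n=\arctan\frac{\beta}{(\nu+1)(\nu+n+2)}$ and $\overline\Delta_n=\frac{E_{n+1}-E_0}{n+1}>0$. -/

import Mathlib

open scoped ContDiff

noncomputable section

/-- The Jacobi polynomial `P_n^{(a,b)}(z)` for arbitrary complex parameters:
`(1/n!) ∑ₖ (n choose k) (a+k+1)_{n-k} (n+a+b+1)_k ((z-1)/2)^k`, where `(c)_k` is the rising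
Pochhammer symbol.  When `a` is not a negative integer this is
`((a+1)_n/n!) ₂F₁(-n, n+a+b+1; a+1; (1-z)/2)`. -/
def jacobiP (n : ℕ) (a b z : ℂ) : ℂ :=
  (1 / (n.factorial : ℂ)) * ∑ k ∈ Finset.range (n + 1),
    (n.choose k : ℂ) * (ascPochhammer ℂ (n - k)).eval (a + k + 1)
      * (ascPochhammer ℂ k).eval (n + a + b + 1) * ((z - 1) / 2) ^ k

/-- The parameters of the Pöschl–Teller model: Planck's constant `ħ`, the mass `M`, the length `L`
of the interval, and the dimensionless parameters `ν`, `β`. -/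
structure PoschlTeller where
  hbar : ℝ
  M : ℝ
  L : ℝ
  nu : ℝ
  beta : ℝ

namespace PoschlTeller

/-- `ε₀ = ħ²π²/(2ML²)`. -/
def eps0 (p : PoschlTeller) : ℝ := p.hbar ^ 2 * Real.pi ^ 2 / (2 * p.M * p.L ^ 2)

/-- The open interval `(0, L)`. -/
def dom (p : PoschlTeller) : Set ℝ := Set.Ioo 0 p.L

/-- Lebesgue measure on `(0, L)`; the Hilbert space is `L²` of this measure. -/
def vol (p : PoschlTeller) : MeasureTheory.Measure ℝ := MeasureTheory.volume.restrict p.dom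

/-- The Pöschl–Teller potential `ε₀ (ν(ν+1)/sin²(πx/L) - 2β cot(πx/L))`. -/
def V0 (p : PoschlTeller) (x : ℝ) : ℝ :=
  p.eps0 * (p.nu * (p.nu + 1) / Real.sin (Real.pi * x / p.L) ^ 2
    - 2 * p.beta * Real.cot (Real.pi * x / p.L))

/-! ### The explicit eigenvalues and eigenfunctions of `H_{ν,β}` -/

/-- `E_n = ε₀ ((n+ν+1)² - β²/(n+ν+1)²)`. -/
def E0 (p : PoschlTeller) (n : ℕ) : ℝ :=
  p.eps0 * ((n + p.nu + 1) ^ 2 - p.beta ^ 2 / (n + p.nu + 1) ^ 2)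

/-- `β/(n+ν+1)`. -/
def bn (p : PoschlTeller) (n : ℕ) : ℝ := p.beta / (n + p.nu + 1)

/-- `a_n = -(n+ν+1) + iβ/(n+ν+1)`. -/
def an (p : PoschlTeller) (n : ℕ) : ℂ := -(n + p.nu + 1) + Complex.I * p.bn n

/-- The double sum `𝒪(n;ν,β)`; it is a positive real number. -/
def bigO (p : PoschlTeller) (n : ℕ) : ℂ :=
  ∑ k ∈ Finset.range (n + 1), ∑ s ∈ Finset.range (n + 1),
    ((ascPochhammer ℂ k).eval (-(n : ℂ)) * (ascPochhammer ℂ k).eval (-2 * p.nu - n - 1 : ℂ)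
      / ((ascPochhammer ℂ k).eval (-p.nu - n - Complex.I * p.bn n : ℂ) * k.factorial
        * Complex.Gamma (n + p.nu + 2 - k + Complex.I * p.bn n)))
    * ((ascPochhammer ℂ s).eval (-(n : ℂ)) * (ascPochhammer ℂ s).eval (-2 * p.nu - n - 1 : ℂ)
      * Complex.Gamma (2 * n + 2 * p.nu - s - k + 3)
      / ((ascPochhammer ℂ s).eval (-p.nu - n + Complex.I * p.bn n : ℂ) * s.factorial
        * Complex.Gamma (n + p.nu + 2 - s - Complex.I * p.bn n)))

/-- `𝒯(n;ν,β) = n! |(-n-ν+iβ/(n+ν+1))_n|⁻¹`. -/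
def bigT (p : PoschlTeller) (n : ℕ) : ℝ :=
  n.factorial * ‖(ascPochhammer ℂ n).eval (-n - p.nu + Complex.I * p.bn n : ℂ)‖⁻¹

/-- The normalization constant
`K_n = 2^{n+ν+1} L^{-1/2} 𝒯(n;ν,β) 𝒪(n;ν,β)^{-1/2} exp(βπ/(2(n+ν+1)))`. -/
def Kn (p : PoschlTeller) (n : ℕ) : ℝ :=
  (2 : ℝ) ^ ((n : ℝ) + p.nu + 1) * (Real.sqrt p.L)⁻¹ * p.bigT n * (Real.sqrt (p.bigO n).re)⁻¹
    * Real.exp (p.beta * Real.pi / (2 * (n + p.nu + 1)))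

/-- `φ_n(x) = K_n sin^{ν+n+1}(πx/L) exp(-βπx/(L(ν+n+1))) P_n^{(a_n, ā_n)}(i cot(πx/L))`. -/
def phi0 (p : PoschlTeller) (n : ℕ) (x : ℝ) : ℂ :=
  ((p.Kn n * Real.sin (Real.pi * x / p.L) ^ (p.nu + n + 1)
      * Real.exp (-(p.beta * Real.pi * x / (p.L * (p.nu + n + 1)))) : ℝ) : ℂ)
    * jacobiP n (p.an n) (starRingEnd ℂ (p.an n))
        (Complex.I * (Real.cot (Real.pi * x / p.L) : ℝ))

/-! ### The hierarchy -/

/-- The superpotential `-ħ g'/g` attached to a function `g`. -/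
def superpotOf (p : PoschlTeller) (g : ℝ → ℂ) (x : ℝ) : ℂ := -(p.hbar : ℂ) * (deriv g x / g x)

/-- The differential operator `ħ d/dx + W`. -/
def opA (p : PoschlTeller) (W f : ℝ → ℂ) (x : ℝ) : ℂ := p.hbar * deriv f x + W x * f x

/-- The differential operator `-ħ d/dx + W`. -/
def opAdag (p : PoschlTeller) (W f : ℝ → ℂ) (x : ℝ) : ℂ := -(p.hbar * deriv f x) + W x * f x

/-- A function divided by its norm in `L²(0, L)`. -/
def normalize (p : PoschlTeller) (f : ℝ → ℂ) (x : ℝ) : ℂ :=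
  f x / (Real.sqrt (∫ y, ‖f y‖ ^ 2 ∂p.vol) : ℝ)

/-- `E_n^{(m)}`, with `E_n^{(0)} = E_n` and `E_n^{(m+1)} = E_{n+1}^{(m)}`. -/
def energy (p : PoschlTeller) : ℕ → ℕ → ℝ
  | 0, n => p.E0 n
  | m + 1, n => p.energy m (n + 1)

/-- `φ_n^{(m)}`, with `φ_n^{(0)} = φ_n` and `φ_n^{(m+1)}` the unit-norm positive multiple of
`A_m φ_{n+1}^{(m)}`, where `A_m = ħ d/dx + W_m` and `W_m = -ħ (φ_0^{(m)})'/φ_0^{(m)}`. -/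
def phi (p : PoschlTeller) : ℕ → ℕ → ℝ → ℂ
  | 0, n => p.phi0 n
  | m + 1, n => p.normalize (p.opA (p.superpotOf (p.phi m 0)) (p.phi m (n + 1)))

/-- The superpotential `W_m = -ħ (φ_0^{(m)})'/φ_0^{(m)}`. -/
def W (p : PoschlTeller) (m : ℕ) : ℝ → ℂ := p.superpotOf (p.phi m 0)

/-- `A_m = ħ d/dx + W_m`. -/
def A (p : PoschlTeller) (m : ℕ) (f : ℝ → ℂ) : ℝ → ℂ := p.opA (p.W m) f

/-- `A_m† = -ħ d/dx + W_m`. -/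
def Adag (p : PoschlTeller) (m : ℕ) (f : ℝ → ℂ) : ℝ → ℂ := p.opAdag (p.W m) f

/-- `B_m = A_m A_{m-1} ⋯ A_1 A_0`. -/
def B (p : PoschlTeller) : ℕ → (ℝ → ℂ) → ℝ → ℂ
  | 0, f => p.A 0 f
  | m + 1, f => p.A (m + 1) (p.B m f)

/-- The potentials: `V_0` is the Pöschl–Teller potential and
`V_{m+1} = (W_m² + ħ W_m')/(2M) + E_0^{(m)}`. -/
def V (p : PoschlTeller) : ℕ → ℝ → ℂ
  | 0, x => (p.V0 x : ℝ)
  | m + 1, x => (1 / (2 * p.M : ℂ)) * (p.W m x ^ 2 + p.hbar * deriv (p.W m) x) + p.energy m 0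

/-- The action of the Schrödinger operator `-(ħ²/2M) d²/dx² + V_m`. -/
def schr (p : PoschlTeller) (m : ℕ) (f : ℝ → ℂ) (x : ℝ) : ℂ :=
  -((p.hbar : ℂ) ^ 2 / (2 * p.M)) * deriv (deriv f) x + p.V m x * f x

/-- The action of the hierarchic Hamiltonians: `H^{(0)} = H_{ν,β}` is the Pöschl–Teller
Hamiltonian and `H^{(m+1)} = (1/2M) A_m A_m† + E_0^{(m)}`. -/
def H (p : PoschlTeller) : ℕ → (ℝ → ℂ) → ℝ → ℂ
  | 0, f => p.schr 0 f
  | m + 1, f => fun x =>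
      (1 / (2 * p.M : ℂ)) * p.A m (p.Adag m f) x + p.energy m 0 * f x

/-- Local absolute continuity on `(0, L)`: `f` is an indefinite integral of a function that is
integrable on every compact subinterval. -/
def LocAC (p : PoschlTeller) (f : ℝ → ℂ) : Prop :=
  ∃ g : ℝ → ℂ, ∀ a ∈ p.dom, ∀ b ∈ p.dom,
    IntervalIntegrable g MeasureTheory.volume a b ∧ f b = f a + ∫ t in a..b, g t

/-- The domain of `H^{(m)}`: square-integrable functions with locally absolutely continuous first
derivative, satisfying Dirichlet conditions at both ends, and with `H^{(m)} f ∈ L²(0, L)`. -/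
def InDomain (p : PoschlTeller) (m : ℕ) (f : ℝ → ℂ) : Prop :=
  MeasureTheory.MemLp f 2 p.vol ∧
  DifferentiableOn ℝ f p.dom ∧ p.LocAC (deriv f) ∧
  Filter.Tendsto f (nhdsWithin 0 (Set.Ioi 0)) (nhds 0) ∧
  Filter.Tendsto f (nhdsWithin p.L (Set.Iio p.L)) (nhds 0) ∧
  MeasureTheory.MemLp (p.H m f) 2 p.vol

/-- `f` is a normalized eigenfunction of `H^{(m)}`, with eigenvalue `e`; it lies in the domain, is
smooth on `(0, L)`, and satisfies the eigenvalue equation at every point. -/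
def IsNormalizedEigenfunction (p : PoschlTeller) (m : ℕ) (e : ℝ) (f : ℝ → ℂ) : Prop :=
  p.InDomain m f ∧ ContDiffOn ℝ ∞ f p.dom ∧ (∀ x ∈ p.dom, p.H m f x = e * f x) ∧
  ∫ x, ‖f x‖ ^ 2 ∂p.vol = 1

/-- `(E_{n+1} - E_0)/(n+1)`. -/
def meanGap (p : PoschlTeller) (n : ℕ) : ℝ := (p.E0 (n + 1) - p.E0 0) / (n + 1)

/-- `α(n) = arctan(β/((ν+1)(ν+n+2)))`. -/
def alpha (p : PoschlTeller) (n : ℕ) : ℝ :=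
  Real.arctan (p.beta / ((p.nu + 1) * (p.nu + n + 2)))

/-- The closed form of `φ_n^{(1)}`. -/
def phi1Explicit (p : PoschlTeller) (n : ℕ) (x : ℝ) : ℂ :=
  (((2 : ℝ) ^ ((n : ℝ) + p.nu + 2) * Real.exp (p.beta * Real.pi / (2 * (n + p.nu + 2)))
      * p.bigT (n + 1)
      / Real.sqrt (2 * p.M * p.L * (n + 1) * (p.bigO (n + 1)).re * p.meanGap n) : ℝ) : ℂ)
  * (((Real.sqrt (2 * p.M * (n + 1) ^ 2 * p.meanGap n / (n + 2 * p.nu + 3))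
        * Real.cos (Real.pi * x / p.L - p.alpha n) : ℝ) : ℂ)
      * jacobiP (n + 1) (p.an (n + 1)) (starRingEnd ℂ (p.an (n + 1)))
          (Complex.I * (Real.cot (Real.pi * x / p.L) : ℝ))
    + Complex.I * ((Real.pi * p.hbar * (n + 2 * p.nu + 2)
        / (2 * p.L * Real.sin (Real.pi * x / p.L)) : ℝ) : ℂ)
      * jacobiP n (p.an (n + 1) + 1) (starRingEnd ℂ (p.an (n + 1)) + 1)
          (Complex.I * (Real.cot (Real.pi * x / p.L) : ℝ)))
  * ((Real.sin (Real.pi * x / p.L) ^ (p.nu + n + 1)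
      * Real.exp (-(p.beta * Real.pi * x / (p.L * (p.nu + n + 2)))) : ℝ) : ℂ)

end PoschlTeller

end

/-! The theorem is an instance of shape invariance. In units with ħ²/2M = 1, let u be the
logarithmic derivative of the ground state g = sin^{l+1}(πx/L) exp(-bπx/(L(l+1))). It satisfies two
Riccati equations: u² + u' is the potential with parameter l minus the ground level
(`logSlope_sq_add`), and u² - u' is the potential with parameter l + 1 minus the same level
(`logSlope_sq_sub`). So A = d/dx - u maps solutions for l to solutions for l + 1 and keeps the
energy, and the m-th member of the hierarchy is the original system with ν replaced by ν + m
(`phi_eq`, `V_eq_pot`), up to unimodular constants that logarithmic derivatives do not see.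

The spectrum follows from ‖Af‖² = (e - level)‖f‖² (`IsSol.normSq_lower`): e is real and at least the
ground level, equality forces Af = 0, hence f is a multiple of g, and otherwise A is injective.
Repeated lowering raises the ground level past e, so e must equal some level (`IsSol.exists_level`);
the same induction shows simplicity (`IsSol.exists_eq_const_mul`). The analytic core is that Af
again vanishes at both ends (`IsSol.tendsto_lower_left`).

Two explicit computations remain. The Jacobi equation, combined with the Riccati equation at
parameter ν + n, shows that φ_n solves the original problem (`hasDerivAt_deriv_psi`). Expanding
|φ_n|² into terms sin^p θ e^{iqθ}, whose integrals are quotients of Gamma functions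
(`sinExpIntegral_eq`), identifies 𝒪(n) with ‖φ_n‖² up to a positive factor (`normSq_psi`); this
gives both positivity and normalization. -/

noncomputable section

open MeasureTheory Set Filter Topology

/-! ### The integral of sin^p θ e^{iqθ} by Gamma functions -/

/-- The integral `∫₀^π sin^p θ e^{iqθ} dθ`. -/
def sinExpIntegral (p : ℝ) (q : ℂ) : ℂ :=
  ∫ t in (0 : ℝ)..Real.pi, ((Real.sin t ^ p : ℝ) : ℂ) * Complex.exp (Complex.I * q * t)

theorem hasDerivAt_cexp_mul_real (c : ℂ) (t : ℝ) :
    HasDerivAt (fun t : ℝ => Complex.exp (c * t)) (c * Complex.exp (c * t)) t := by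
  have h : HasDerivAt (fun t : ℝ => c * (t : ℂ)) (c * 1) t :=
    (HasDerivAt.ofReal_comp (hasDerivAt_id t)).const_mul c
  simpa [mul_comm] using h.cexp

theorem continuous_sin_rpow_mul_cexp {p : ℝ} (hp : 0 ≤ p) (q : ℂ) :
    Continuous fun t : ℝ => ((Real.sin t ^ p : ℝ) : ℂ) * Complex.exp (Complex.I * q * t) := by
  have h := (Real.continuous_rpow_const hp).comp Real.continuous_sin
  exact (Complex.continuous_ofReal.comp h).mul (by fun_prop)

/-- Two integrations by parts in one: sin^{p+1} e^{iqt} ((p+2) cos t - iq sin t) vanishes at 0 and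
π, and its derivative is the difference of the two integrands, the mixed sin·cos terms cancelling.
-/
theorem sinExpIntegral_add_two {p : ℝ} (hp : 0 ≤ p) (q : ℂ) :
    ((p + 2) ^ 2 - q ^ 2) * sinExpIntegral (p + 2) q
      = (p + 2) * (p + 1) * sinExpIntegral p q := by
  have hI1 : IntervalIntegrable (fun t : ℝ => ((Real.sin t ^ p : ℝ) : ℂ)
      * Complex.exp (Complex.I * q * t)) volume 0 Real.pi :=
    (continuous_sin_rpow_mul_cexp hp q).intervalIntegrable _ _
  have hI2 : IntervalIntegrable (fun t : ℝ => ((Real.sin t ^ (p + 2) : ℝ) : ℂ)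
      * Complex.exp (Complex.I * q * t)) volume 0 Real.pi :=
    (continuous_sin_rpow_mul_cexp (by linarith) q).intervalIntegrable _ _
  have key := intervalIntegral.integral_eq_sub_of_hasDerivAt_of_le
    (f := fun t : ℝ => ((Real.sin t ^ (p + 1) : ℝ) : ℂ) * Complex.exp (Complex.I * q * t)
      * ((p + 2) * (Real.cos t : ℂ) - Complex.I * q * (Real.sin t : ℂ)))
    (f' := fun t : ℝ => (p + 2) * (p + 1) * (((Real.sin t ^ p : ℝ) : ℂ)
      * Complex.exp (Complex.I * q * t)) - ((p + 2) ^ 2 - q ^ 2)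
        * (((Real.sin t ^ (p + 2) : ℝ) : ℂ) * Complex.exp (Complex.I * q * t)))
    Real.pi_pos.le
    (((continuous_sin_rpow_mul_cexp (by linarith) q).mul (by fun_prop)).continuousOn)
    (by
      intro t ht
      have hs : 0 < Real.sin t := Real.sin_pos_of_mem_Ioo ht
      have h1 : HasDerivAt (fun t : ℝ => ((Real.sin t ^ (p + 1) : ℝ) : ℂ))
          ((Real.cos t * (p + 1) * Real.sin t ^ p : ℝ) : ℂ) t := by
        have := (Real.hasDerivAt_sin t).rpow_const (p := p + 1) (Or.inl hs.ne')
        rw [add_sub_cancel_right] at this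
        exact this.ofReal_comp
      have h2 : HasDerivAt (fun t : ℝ => (p + 2) * (Real.cos t : ℂ)
          - Complex.I * q * (Real.sin t : ℂ))
          ((p + 2) * ((-Real.sin t : ℝ) : ℂ) - Complex.I * q * (Real.cos t : ℂ)) t :=
        ((Real.hasDerivAt_cos t).ofReal_comp.const_mul _).sub
          ((Real.hasDerivAt_sin t).ofReal_comp.const_mul _)
      convert! (h1.mul (hasDerivAt_cexp_mul_real (Complex.I * q) t)).mul h2 using 1
      have e1 : Real.sin t ^ (p + 1) = Real.sin t ^ p * Real.sin t := by
        rw [Real.rpow_add hs, Real.rpow_one]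
      have e2 : Real.sin t ^ (p + 2) = Real.sin t ^ p * Real.sin t ^ 2 := by
        rw [Real.rpow_add hs]; norm_cast
      simp only [Pi.mul_apply]
      rw [e1, e2]
      have h3 : (Real.cos t : ℂ) ^ 2 = 1 - (Real.sin t : ℂ) ^ 2 := by
        rw [eq_sub_iff_add_eq]; exact_mod_cast Real.cos_sq_add_sin_sq t
      push_cast at h3 ⊢
      generalize Complex.exp _ = E
      linear_combination (-(p + 1) * (p + 2) * (Real.sin t ^ p : ℝ) * E) * h3
        + q ^ 2 * (Real.sin t ^ p : ℝ) * E * (Complex.sin t) ^ 2 * Complex.I_sq)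
    ((hI1.const_mul _).sub (hI2.const_mul _))
  rw [intervalIntegral.integral_sub (hI1.const_mul _) (hI2.const_mul _),
    intervalIntegral.integral_const_mul, intervalIntegral.integral_const_mul] at key
  have hz : (0 : ℝ) ^ (p + 1) = 0 := Real.zero_rpow (by linarith)
  simp only [Real.sin_pi, Real.sin_zero, hz, Complex.ofReal_zero, zero_mul, sub_zero] at key
  exact (sub_eq_zero.mp key).symm

theorem sinExpIntegral_zero_zero : sinExpIntegral 0 0 = Real.pi := by
  simp [sinExpIntegral]

/-- Wallis' integral, the yardstick for the asymptotics of the general integral. -/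
theorem sinExpIntegral_even (N : ℕ) :
    sinExpIntegral (2 * N : ℕ) 0 = Real.pi * (2 * N).factorial / (4 ^ N * (N.factorial : ℂ) ^ 2) := by
  induction N with
  | zero => simpa using sinExpIntegral_zero_zero
  | succ N ih =>
    have h := sinExpIntegral_add_two (p := ((2 * N : ℕ) : ℝ)) (by positivity) 0
    rw [ih] at h
    have e : ((2 * (N + 1) : ℕ) : ℝ) = ((2 * N : ℕ) : ℝ) + 2 := by push_cast; ring
    rw [e]
    have h2 : ((2 * (N + 1)).factorial : ℂ) = (2 * N + 2) * (2 * N + 1) * (2 * N).factorial := by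
      rw [show 2 * (N + 1) = 2 * N + 1 + 1 by ring, Nat.factorial_succ, Nat.factorial_succ]
      push_cast; ring
    have h3 : ((N + 1).factorial : ℂ) = (N + 1) * N.factorial := by
      rw [Nat.factorial_succ]; push_cast; ring
    have hN : (N : ℂ) + 1 ≠ 0 := by exact_mod_cast N.succ_ne_zero
    have hf : (N.factorial : ℂ) ≠ 0 := by exact_mod_cast N.factorial_ne_zero
    rw [h2, h3, pow_succ]
    have hN2 : (2 * (N : ℂ) + 2) ≠ 0 := by
      rw [show 2 * (N : ℂ) + 2 = 2 * (N + 1) by ring]; exact mul_ne_zero two_ne_zero hN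
    apply mul_left_cancel₀ (pow_ne_zero 2 hN2)
    push_cast at h ⊢
    rw [zero_pow two_ne_zero, sub_zero] at h
    rw [h]
    field_simp
    ring

/-- Laplace's principle: the normalized weights sin^{2N} concentrate at π/2, the unique maximum of
sin², where the remaining factor sin^p t e^{iqt} takes the value e^{iqπ/2}. -/
theorem tendsto_sinExpIntegral_div (p : ℝ) (hp : 0 ≤ p) (q : ℂ) :
    Tendsto (fun N : ℕ => sinExpIntegral (p + (2 * N : ℕ)) q / sinExpIntegral (2 * N : ℕ) 0) atTop
      (𝓝 (Complex.exp (Complex.I * q * (Real.pi / 2 : ℝ)))) := by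
  have key := tendsto_setIntegral_pow_smul_of_unique_maximum_of_isCompact_of_continuousOn
    (μ := volume) (s := Icc 0 Real.pi) (c := fun t => Real.sin t ^ 2) (x₀ := Real.pi / 2)
    (g := fun t : ℝ => ((Real.sin t ^ p : ℝ) : ℂ) * Complex.exp (Complex.I * q * t))
    isCompact_Icc (by fun_prop) (by
      intro y hy hne
      rw [Real.sin_pi_div_two]
      have h1 : Real.cos y ≠ 0 := by
        intro h0
        apply hne
        exact Real.injOn_cos hy ⟨by positivity, by linarith [Real.pi_pos]⟩
          (by rw [h0, Real.cos_pi_div_two])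
      have := Real.sin_sq_add_cos_sq y
      have : 0 < Real.cos y ^ 2 := by positivity
      rw [one_pow]; linarith) (fun x _ => by positivity) (by simp)
    (by
      rw [interior_Icc, closure_Ioo Real.pi_pos.ne]
      exact ⟨by positivity, by linarith [Real.pi_pos]⟩)
    (continuous_sin_rpow_mul_cexp hp q).continuousOn
  simp only [Real.sin_pi_div_two, Real.one_rpow, Complex.ofReal_one, one_mul] at key
  refine key.congr fun N => ?_
  have e1 : (∫ x in Icc 0 Real.pi, (Real.sin x ^ 2) ^ N • (((Real.sin x ^ p : ℝ) : ℂ)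
      * Complex.exp (Complex.I * q * x))) = sinExpIntegral (p + (2 * N : ℕ)) q := by
    rw [sinExpIntegral, intervalIntegral.integral_of_le Real.pi_pos.le, integral_Icc_eq_integral_Ioc]
    refine setIntegral_congr_fun measurableSet_Ioc fun x hx => ?_
    have hs : 0 ≤ Real.sin x := Real.sin_nonneg_of_nonneg_of_le_pi hx.1.le hx.2
    rw [Real.rpow_add_of_nonneg hs hp (by positivity), Real.rpow_natCast, pow_mul,
      Complex.real_smul]
    push_cast
    ring
  have e2 : ((∫ x in Icc 0 Real.pi, (Real.sin x ^ 2) ^ N : ℝ) : ℂ)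
      = sinExpIntegral (2 * N : ℕ) 0 := by
    rw [sinExpIntegral, intervalIntegral.integral_of_le Real.pi_pos.le,
      integral_Icc_eq_integral_Ioc, ← integral_complex_ofReal]
    refine setIntegral_congr_fun measurableSet_Ioc fun x hx => ?_
    simp only [mul_zero, zero_mul, Complex.exp_zero, mul_one, Real.rpow_natCast, pow_mul]
  rw [e1, Complex.real_smul, ← e2]
  push_cast
  rw [div_eq_inv_mul]

/-- Euler's limit for Γ(s), divided by Γ(s); the product in `GammaSeq` is absorbed by the functional
equation. -/
theorem tendsto_cpow_mul_factorial_div_Gamma {s : ℂ} (hs : 0 < s.re) :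
    Tendsto (fun n : ℕ => (n : ℂ) ^ s * n.factorial / Complex.Gamma (s + n + 1)) atTop (𝓝 1) := by
  have h := (Complex.GammaSeq_tendsto_Gamma s).div_const (Complex.Gamma s)
  have hG : Complex.Gamma s ≠ 0 := Complex.Gamma_ne_zero_of_re_pos hs
  rw [div_self hG] at h
  refine h.congr fun n => ?_
  have h1 : ∀ m : ℕ, Complex.Gamma (s + m) = (∏ j ∈ Finset.range m, (s + j)) * Complex.Gamma s := by
    intro m
    induction m with
    | zero => simp
    | succ m ih =>
      have h0 : s + m ≠ 0 := by
        intro h0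
        have := congrArg Complex.re h0
        simp at this
        have : (0 : ℝ) ≤ m := by positivity
        linarith
      push_cast
      rw [← add_assoc, Complex.Gamma_add_one _ h0, ih, Finset.prod_range_succ]
      ring
  have := h1 (n + 1)
  push_cast at this
  rw [add_assoc, this, Complex.GammaSeq, div_div]

/-- The claimed quotient does not change when p grows by 2, because (p+2)² - (α-β)² = 4(α+1)(β+1).
Its value is then found in the limit of large exponents. -/
theorem sinExpIntegral_eq {p : ℝ} {α β : ℂ} (hα : 0 < α.re) (hβ : 0 < β.re) (hp : α + β = p) :
    sinExpIntegral p (α - β) = Real.pi * Complex.exp (Complex.I * (α - β) * (Real.pi / 2 : ℝ))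
      * Complex.Gamma (p + 1)
      / ((2 ^ p : ℝ) * (Complex.Gamma (α + 1) * Complex.Gamma (β + 1))) := by
  have hp0 : 0 < p := by
    have := congrArg Complex.re hp
    simp at this
    linarith
  have hG : ∀ z : ℂ, 0 < z.re → ∀ n : ℕ, Complex.Gamma (z + n + 1) ≠ 0 := fun z hz n =>
    Complex.Gamma_ne_zero_of_re_pos (by simp; positivity)
  have hpre : 0 < (p : ℂ).re := by simpa using hp0
  -- `Q N` is the quotient for the parameters α + N, β + N, p + 2N; the recursion makes it
  -- independent of N.
  set Q : ℕ → ℂ := fun N => sinExpIntegral (p + (2 * N : ℕ)) (α - β) * 4 ^ N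
    * (Complex.Gamma (α + N + 1) * Complex.Gamma (β + N + 1))
      / Complex.Gamma (p + (2 * N : ℕ) + 1) with hQ
  have hstep : ∀ N, Q (N + 1) = Q N := by
    intro N
    have h := sinExpIntegral_add_two (p := p + (2 * N : ℕ)) (by positivity) (α - β)
    have a1 : α + N + 1 ≠ 0 := fun h0 => by
      have := congrArg Complex.re h0
      simp at this
      have : (0 : ℝ) ≤ N := by positivity
      linarith
    have b1 : β + N + 1 ≠ 0 := fun h0 => by
      have := congrArg Complex.re h0
      simp at this
      have : (0 : ℝ) ≤ N := by positivity
      linarith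
    have p1 : (p : ℂ) + (2 * N : ℕ) + 1 ≠ 0 := by
      have : (0 : ℝ) < p + (2 * N : ℕ) + 1 := by positivity
      exact_mod_cast this.ne'
    have p2 : (p : ℂ) + (2 * N : ℕ) + 1 + 1 ≠ 0 := by
      have : (0 : ℝ) < p + (2 * N : ℕ) + 1 + 1 := by positivity
      exact_mod_cast this.ne'
    have gp := hG p hpre (2 * N)
    simp only [hQ]
    have e1 : p + ((2 * (N + 1) : ℕ) : ℝ) = p + (2 * N : ℕ) + 2 := by push_cast; ring
    have e2 : (p : ℂ) + ((2 * (N + 1) : ℕ) : ℂ) + 1 = p + (2 * N : ℕ) + 1 + 1 + 1 := by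
      push_cast; ring
    have e3 : ∀ z : ℂ, z + ((N + 1 : ℕ) : ℂ) + 1 = z + N + 1 + 1 := fun z => by push_cast; ring
    rw [e1, e2, e3, e3, Complex.Gamma_add_one _ a1, Complex.Gamma_add_one _ b1,
      Complex.Gamma_add_one _ p2, Complex.Gamma_add_one _ p1, pow_succ]
    generalize sinExpIntegral (p + (2 * N : ℕ) + 2) (α - β) = J2 at h ⊢
    generalize sinExpIntegral (p + (2 * N : ℕ)) (α - β) = J at h ⊢
    generalize Complex.Gamma (α + N + 1) = ga
    generalize Complex.Gamma (β + N + 1) = gb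
    generalize Complex.Gamma ((p : ℂ) + (2 * N : ℕ) + 1) = g at gp ⊢
    rw [div_eq_div_iff (mul_ne_zero p2 (mul_ne_zero p1 gp)) gp]
    push_cast at h ⊢
    rw [← hp] at h ⊢
    linear_combination 4 ^ N * ga * gb * g * h
  have hconst : ∀ N, Q N = Q 0 := fun N => by
    induction N with
    | zero => rfl
    | succ N ih => rw [hstep, ih]
  have t1 := tendsto_sinExpIntegral_div p hp0.le (α - β)
  have ta := (tendsto_cpow_mul_factorial_div_Gamma hα).inv₀ one_ne_zero
  have tb := (tendsto_cpow_mul_factorial_div_Gamma hβ).inv₀ one_ne_zero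
  -- Euler's limit along n = 2N, to match Γ(p + 2N + 1). Wallis' value then cancels all the
  -- factorials, and (2N)^p = 2^p N^α N^β cancels the powers.
  have tp := (tendsto_cpow_mul_factorial_div_Gamma hpre).comp
    (tendsto_id.const_mul_atTop' (r := 2) two_pos)
  have tQ := (((t1.mul ta).mul tb).mul tp).const_mul ((Real.pi : ℂ) / (2 ^ p : ℝ))
  have h2p : ((2 ^ p : ℝ) : ℂ) ≠ 0 := by
    exact_mod_cast (Real.rpow_pos_of_pos two_pos p).ne'
  have hlim : Tendsto Q atTop (𝓝 (Real.pi / (2 ^ p : ℝ)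
      * (Complex.exp (Complex.I * (α - β) * (Real.pi / 2 : ℝ)) * 1⁻¹ * 1⁻¹ * 1))) := by
    refine tQ.congr' ?_
    filter_upwards [eventually_gt_atTop 0] with N hN
    have hNc : (N : ℂ) ≠ 0 := by exact_mod_cast hN.ne'
    have c1 : (((2 * N : ℕ) : ℂ)) ^ (p : ℂ) = (2 ^ p : ℝ) * ((N : ℂ) ^ α * (N : ℂ) ^ β) := by
      rw [← Complex.cpow_add _ _ hNc, hp, Complex.ofReal_cpow two_pos.le]
      have := Complex.mul_cpow_ofReal_nonneg two_pos.le N.cast_nonneg (p : ℂ)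
      push_cast at this ⊢
      exact this
    have na : (N : ℂ) ^ α ≠ 0 := by simp [Complex.cpow_eq_zero_iff, hNc]
    have nb : (N : ℂ) ^ β ≠ 0 := by simp [Complex.cpow_eq_zero_iff, hNc]
    have ga := hG α hα N
    have gb := hG β hβ N
    have gp := hG p hpre (2 * N)
    have hf : (N.factorial : ℂ) ≠ 0 := by exact_mod_cast N.factorial_ne_zero
    have hf2 : ((2 * N).factorial : ℂ) ≠ 0 := by exact_mod_cast (2 * N).factorial_ne_zero
    have hpi : (Real.pi : ℂ) ≠ 0 := by exact_mod_cast Real.pi_ne_zero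
    simp only [Function.comp, id, hQ]
    rw [c1, sinExpIntegral_even]
    field_simp
  rw [(funext hconst : Q = fun _ => Q 0)] at hlim
  have hfin := tendsto_nhds_unique hlim tendsto_const_nhds
  have ga := hG α hα 0
  have gb := hG β hβ 0
  have gp := hG p hpre 0
  simp only [hQ, Nat.cast_zero, mul_zero, add_zero, pow_zero, mul_one, inv_one] at hfin ga gb gp
  field_simp at hfin ⊢
  linear_combination -hfin

/-! ### Superpotential, Riccati equations and the lowering operator -/

namespace CotWell

/-- The logarithmic derivative of the ground state `groundState`. -/
def logSlope (L b l x : ℝ) : ℝ :=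
  (Real.pi / L) * ((l + 1) * Real.cot (Real.pi * x / L) - b / (l + 1))

/-- The potential `(π/L)² (l(l+1)/sin² - 2b cot)`. -/
def pot (L b l x : ℝ) : ℝ :=
  (Real.pi / L) ^ 2 * (l * (l + 1) / Real.sin (Real.pi * x / L) ^ 2
    - 2 * b * Real.cot (Real.pi * x / L))

/-- The ground state energy. -/
def level (L b l : ℝ) : ℝ := (Real.pi / L) ^ 2 * ((l + 1) ^ 2 - b ^ 2 / (l + 1) ^ 2)

/-- The ground state `sin^{l+1}(πx/L) exp(-bπx/(L(l+1)))`. -/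
def groundState (L b l x : ℝ) : ℝ :=
  Real.sin (Real.pi * x / L) ^ (l + 1) * Real.exp (-(b * Real.pi * x / (L * (l + 1))))

/-- The lowering operator `d/dx - logSlope`. -/
def lowerOp (L b l : ℝ) (f : ℝ → ℂ) (x : ℝ) : ℂ := deriv f x - logSlope L b l x * f x

/-- Solutions on `(0, L)` of `-f'' + pot f = e f` that vanish at both ends. -/
structure IsSol (L b l : ℝ) (e : ℂ) (f : ℝ → ℂ) : Prop where
  diff : ∀ x ∈ Ioo 0 L, DifferentiableAt ℝ f x
  ode : ∀ x ∈ Ioo 0 L, HasDerivAt (deriv f) ((pot L b l x - e) * f x) x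
  left : Tendsto f (𝓝[>] 0) (𝓝 0)
  right : Tendsto f (𝓝[<] L) (𝓝 0)

variable {L b l : ℝ}

theorem sin_pos (hL : 0 < L) {x : ℝ} (hx : x ∈ Ioo 0 L) : 0 < Real.sin (Real.pi * x / L) := by
  apply Real.sin_pos_of_pos_of_lt_pi
  · have := hx.1; positivity
  · rw [div_lt_iff₀ hL]; exact mul_lt_mul_of_pos_left hx.2 Real.pi_pos

theorem hasDerivAt_angle (L x : ℝ) :
    HasDerivAt (fun x : ℝ => Real.pi * x / L) (Real.pi / L) x := by
  simpa using ((hasDerivAt_id x).const_mul Real.pi).div_const L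

theorem cot_sq (hL : 0 < L) {x : ℝ} (hx : x ∈ Ioo 0 L) :
    Real.cot (Real.pi * x / L) ^ 2 = 1 / Real.sin (Real.pi * x / L) ^ 2 - 1 := by
  have hs := (sin_pos hL hx).ne'
  rw [Real.cot_eq_cos_div_sin]
  field_simp
  linarith [Real.sin_sq_add_cos_sq (Real.pi * x / L)]

theorem hasDerivAt_cot (hL : 0 < L) {x : ℝ} (hx : x ∈ Ioo 0 L) :
    HasDerivAt (fun x => Real.cot (Real.pi * x / L))
      (-(Real.pi / L) / Real.sin (Real.pi * x / L) ^ 2) x := by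
  have hs := (sin_pos hL hx).ne'
  have h1 := (hasDerivAt_angle L x).cos.fun_div (hasDerivAt_angle L x).sin hs
  simp only [← Real.cot_eq_cos_div_sin] at h1
  convert! h1 using 1
  congr 1
  linear_combination (Real.pi / L) * Real.sin_sq_add_cos_sq (Real.pi * x / L)

theorem hasDerivAt_logSlope (hL : 0 < L) {x : ℝ} (hx : x ∈ Ioo 0 L) :
    HasDerivAt (logSlope L b l) (-((Real.pi / L) ^ 2 * (l + 1) / Real.sin (Real.pi * x / L) ^ 2)) x := by
  have := (((hasDerivAt_cot hL hx).const_mul (l + 1)).sub_const (b / (l + 1))).const_mul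
    (Real.pi / L)
  convert! this using 1
  ring

/-- The Riccati equation at level `l`. -/
theorem logSlope_sq_add (hL : 0 < L) (hl : 0 < l + 1) {x : ℝ} (hx : x ∈ Ioo 0 L) :
    logSlope L b l x ^ 2 - (Real.pi / L) ^ 2 * (l + 1) / Real.sin (Real.pi * x / L) ^ 2
      = pot L b l x - level L b l := by
  have h := cot_sq hL hx
  have h1 : (l + 1) * (b / (l + 1)) = b := by field_simp
  simp only [logSlope, pot, level, ← div_pow]
  linear_combination (Real.pi / L) ^ 2 * (l + 1) ^ 2 * h
    - 2 * (Real.pi / L) ^ 2 * Real.cot (Real.pi * x / L) * h1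

/-- The Riccati equation that links the levels `l` and `l + 1`. -/
theorem logSlope_sq_sub (hL : 0 < L) (hl : 0 < l + 1) {x : ℝ} (hx : x ∈ Ioo 0 L) :
    logSlope L b l x ^ 2 + (Real.pi / L) ^ 2 * (l + 1) / Real.sin (Real.pi * x / L) ^ 2
      = pot L b (l + 1) x - level L b l := by
  have h := cot_sq hL hx
  have h1 : (l + 1) * (b / (l + 1)) = b := by field_simp
  simp only [logSlope, pot, level, ← div_pow]
  linear_combination (Real.pi / L) ^ 2 * (l + 1) ^ 2 * h
    - 2 * (Real.pi / L) ^ 2 * Real.cot (Real.pi * x / L) * h1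

theorem groundState_pos (hL : 0 < L) {x : ℝ} (hx : x ∈ Ioo 0 L) : 0 < groundState L b l x :=
  mul_pos (Real.rpow_pos_of_pos (sin_pos hL hx) _) (Real.exp_pos _)

theorem hasDerivAt_groundState (hL : 0 < L) {x : ℝ} (hx : x ∈ Ioo 0 L) :
    HasDerivAt (groundState L b l) (logSlope L b l x * groundState L b l x) x := by
  have hs := sin_pos hL hx
  have h1 := (hasDerivAt_angle L x).sin.rpow_const (p := l + 1) (Or.inl hs.ne')
  have h2 : HasDerivAt (fun x => -(b * Real.pi * x / (L * (l + 1))))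
      (-(b * Real.pi / (L * (l + 1)))) x := by
    simpa using (((hasDerivAt_id x).const_mul (b * Real.pi)).div_const (L * (l + 1))).fun_neg
  convert! h1.mul h2.exp using 1
  have e1 : Real.sin (Real.pi * x / L) ^ (l + 1)
      = Real.sin (Real.pi * x / L) ^ (l + 1 - 1) * Real.sin (Real.pi * x / L) := by
    rw [← Real.rpow_add_one hs.ne']; ring_nf
  simp only [logSlope, groundState, Real.cot_eq_cos_div_sin]
  rw [e1]
  have e2 : b * Real.pi / (L * (l + 1)) = (Real.pi / L) * (b / (l + 1)) := by
    rw [div_mul_div_comm]; ring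
  rw [e2]
  generalize b / (l + 1) = q
  field_simp
  ring

theorem IsSol.congr {e : ℂ} {f g : ℝ → ℂ} (hf : IsSol L b l e f) (hL : 0 < L)
    (h : EqOn f g (Ioo 0 L)) : IsSol L b l e g := by
  have hev : ∀ x ∈ Ioo 0 L, g =ᶠ[𝓝 x] f := fun x hx => by
    filter_upwards [isOpen_Ioo.mem_nhds hx] with y hy using (h hy).symm
  refine ⟨fun x hx => (hf.diff x hx).congr_of_eventuallyEq (hev x hx), fun x hx => ?_, ?_, ?_⟩
  · rw [← h hx]
    exact (hf.ode x hx).congr_of_eventuallyEq (hev x hx).deriv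
  · refine hf.left.congr' ?_
    filter_upwards [Ioo_mem_nhdsGT hL] with y hy using h hy
  · refine hf.right.congr' ?_
    filter_upwards [Ioo_mem_nhdsLT hL] with y hy using h hy

theorem IsSol.sub_const_mul {e : ℂ} {f g : ℝ → ℂ} (hg : IsSol L b l e g) (hf : IsSol L b l e f)
    (c : ℂ) : IsSol L b l e (fun x => g x - c * f x) := by
  have hd : ∀ x ∈ Ioo 0 L, deriv (fun x => g x - c * f x) x = deriv g x - c * deriv f x :=
    fun x hx => ((hg.diff x hx).hasDerivAt.sub ((hf.diff x hx).hasDerivAt.const_mul c)).deriv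
  refine ⟨fun x hx => (hg.diff x hx).sub ((hf.diff x hx).const_mul c), fun x hx => ?_, ?_, ?_⟩
  · have h1 := (hg.ode x hx).sub ((hf.ode x hx).const_mul c)
    have h2 : deriv (fun x => g x - c * f x) =ᶠ[𝓝 x] fun x => deriv g x - c * deriv f x := by
      filter_upwards [isOpen_Ioo.mem_nhds hx] with y hy using hd y hy
    convert! h1.congr_of_eventuallyEq h2 using 1
    ring
  · simpa using hg.left.sub (hf.left.const_mul c)
  · simpa using hg.right.sub (hf.right.const_mul c)

/-- Reflection x ↦ L - x turns b into -b, so behaviour at L follows from behaviour at 0 once the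
latter is known for b of either sign. -/
theorem pot_reflect (hL : L ≠ 0) (x : ℝ) : pot L b l (L - x) = pot L (-b) l x := by
  have h : Real.pi * (L - x) / L = Real.pi - Real.pi * x / L := by field_simp
  simp only [pot, h, Real.sin_pi_sub, Real.cot_eq_cos_div_sin, Real.cos_pi_sub]
  ring

theorem logSlope_reflect (hL : L ≠ 0) (x : ℝ) : logSlope L b l (L - x) = -logSlope L (-b) l x := by
  have h : Real.pi * (L - x) / L = Real.pi - Real.pi * x / L := by field_simp
  simp only [logSlope, h, Real.sin_pi_sub, Real.cot_eq_cos_div_sin, Real.cos_pi_sub]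
  ring

theorem tendsto_reflect_left (L : ℝ) : Tendsto (fun x => L - x) (𝓝[>] 0) (𝓝[<] L) := by
  refine tendsto_nhdsWithin_iff.mpr ⟨?_, ?_⟩
  · have : Tendsto (fun x : ℝ => L - x) (𝓝 0) (𝓝 (L - 0)) := by
      apply Continuous.tendsto; fun_prop
    rw [sub_zero] at this
    exact this.mono_left nhdsWithin_le_nhds
  · filter_upwards [self_mem_nhdsWithin] with x hx
    simpa using hx

theorem tendsto_reflect_right (L : ℝ) : Tendsto (fun x => L - x) (𝓝[<] L) (𝓝[>] 0) := by
  refine tendsto_nhdsWithin_iff.mpr ⟨?_, ?_⟩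
  · have : Tendsto (fun x : ℝ => L - x) (𝓝 L) (𝓝 (L - L)) := by
      apply Continuous.tendsto; fun_prop
    rw [sub_self] at this
    exact this.mono_left nhdsWithin_le_nhds
  · filter_upwards [self_mem_nhdsWithin] with x hx
    simpa using hx

theorem IsSol.reflect {e : ℂ} {f : ℝ → ℂ} (hf : IsSol L b l e f) (hL : 0 < L) :
    IsSol L (-b) l e (fun x => f (L - x)) := by
  have hm : ∀ x ∈ Ioo 0 L, L - x ∈ Ioo 0 L := fun x hx => ⟨by linarith [hx.2], by linarith [hx.1]⟩
  refine ⟨fun x hx => ?_, fun x hx => ?_, hf.right.comp (tendsto_reflect_left L),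
    hf.left.comp (tendsto_reflect_right L)⟩
  · exact (hf.diff _ (hm x hx)).comp x (by fun_prop)
  · have h1 := (hf.ode _ (hm x hx)).comp_const_sub L x
    have h2 : deriv (fun x => f (L - x)) = fun x => -deriv f (L - x) := by
      funext y; exact deriv_comp_const_sub f L y
    rw [h2, ← pot_reflect hL.ne']
    simpa using h1.fun_neg

theorem lower_reflect (hL : L ≠ 0) (f : ℝ → ℂ) (x : ℝ) :
    lowerOp L (-b) l (fun x => f (L - x)) x = -lowerOp L b l f (L - x) := by
  simp only [lowerOp, deriv_comp_const_sub, logSlope_reflect hL]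
  push_cast; ring

/-- This is A†Af = (e - level) f, written as a first-order equation for Af: the term u' from
differentiating uf is removed by the first Riccati equation. -/
theorem IsSol.hasDerivAt_lower {e : ℂ} {f : ℝ → ℂ} (hf : IsSol L b l e f) (hL : 0 < L)
    (hl : 0 < l + 1) {x : ℝ} (hx : x ∈ Ioo 0 L) :
    HasDerivAt (lowerOp L b l f)
      (-(logSlope L b l x * lowerOp L b l f x) - (e - level L b l) * f x) x := by
  have h1 := (hf.ode x hx).sub
    ((hasDerivAt_logSlope (b := b) (l := l) hL hx).ofReal_comp.mul (hf.diff x hx).hasDerivAt)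
  convert! h1 using 1
  have h2 := congrArg (fun r : ℝ => (r : ℂ)) (logSlope_sq_add (b := b) hL hl hx)
  simp only [lowerOp]
  push_cast at h2 ⊢
  linear_combination f x * h2

/-! ### Lowered solutions satisfy the Dirichlet conditions -/

/-- Functions continuous on `(0, L)` with limits at both ends are bounded. -/
theorem exists_bound {g : ℝ → ℂ} {u v : ℂ} (hL : 0 < L) (hg : ContinuousOn g (Ioo 0 L))
    (h0 : Tendsto g (𝓝[>] 0) (𝓝 u)) (h1 : Tendsto g (𝓝[<] L) (𝓝 v)) :
    ∃ B, 0 ≤ B ∧ ∀ x ∈ Ioo 0 L, ‖g x‖ ≤ B := by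
  have hc := continuousOn_Icc_extendFrom_Ioo hg h0 h1
  obtain ⟨B, hB⟩ := isCompact_Icc.exists_bound_of_continuousOn hc
  refine ⟨B, (norm_nonneg _).trans (hB 0 ⟨le_rfl, hL.le⟩), fun x hx => ?_⟩
  have := hB x ⟨hx.1.le, hx.2.le⟩
  rwa [extendFrom_eq (by rw [closure_Ioo hL.ne]; exact ⟨hx.1.le, hx.2.le⟩)
    (hg x hx)] at this

theorem IsSol.continuousOn {e : ℂ} {f : ℝ → ℂ} (hf : IsSol L b l e f) :
    ContinuousOn f (Ioo 0 L) := fun x hx => (hf.diff x hx).continuousAt.continuousWithinAt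

theorem exp_le_two_near_zero (L b l : ℝ) :
    ∀ᶠ x in 𝓝[>] (0 : ℝ), Real.exp (-(b * Real.pi * x / (L * (l + 1)))) ≤ 2 := by
  have h : Tendsto (fun x : ℝ => Real.exp (-(b * Real.pi * x / (L * (l + 1))))) (𝓝 0)
      (𝓝 (Real.exp (-(b * Real.pi * 0 / (L * (l + 1)))))) := by
    apply Continuous.tendsto; fun_prop
  simp only [mul_zero, zero_div, neg_zero, Real.exp_zero] at h
  exact (h.mono_left nhdsWithin_le_nhds).eventually (eventually_le_nhds one_lt_two)

theorem groundState_eq (hL : 0 < L) {x : ℝ} (hx : x ∈ Ioo 0 L) :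
    groundState L b l x = Real.sin (Real.pi * x / L) ^ l * Real.sin (Real.pi * x / L)
      * Real.exp (-(b * Real.pi * x / (L * (l + 1)))) := by
  rw [groundState, Real.rpow_add_one (sin_pos hL hx).ne']

/-- The cotangent dominates near 0; hence the ground state increases there. -/
theorem logSlope_nonneg_near_zero (hL : 0 < L) (hl : 0 ≤ l) : ∀ᶠ x in 𝓝[>] (0 : ℝ), 0 ≤ logSlope L b l x := by
  have h : Tendsto (fun x : ℝ => (l + 1) * Real.cos (Real.pi * x / L)
      - b / (l + 1) * Real.sin (Real.pi * x / L)) (𝓝 0)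
      (𝓝 ((l + 1) * Real.cos (Real.pi * 0 / L) - b / (l + 1) * Real.sin (Real.pi * 0 / L))) := by
    apply Continuous.tendsto; fun_prop
  simp only [mul_zero, zero_div, Real.cos_zero, Real.sin_zero, sub_zero, mul_one] at h
  filter_upwards [(h.mono_left nhdsWithin_le_nhds).eventually
    (eventually_ge_nhds (show 0 < l + 1 by linarith)), Ioo_mem_nhdsGT hL] with x hx hxL
  have hs := sin_pos hL hxL
  have : logSlope L b l x = Real.pi / L * (((l + 1) * Real.cos (Real.pi * x / L)
      - b / (l + 1) * Real.sin (Real.pi * x / L)) / Real.sin (Real.pi * x / L)) := by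
    rw [logSlope, Real.cot_eq_cos_div_sin]
    generalize b / (l + 1) = q
    field_simp
  rw [this]
  have := Real.pi_pos
  positivity

theorem groundState_le_near_zero (hL : 0 < L) (hl : 0 ≤ l) :
    ∀ᶠ x in 𝓝[>] (0 : ℝ), groundState L b l x ≤ 2 * Real.pi / L * x := by
  filter_upwards [exp_le_two_near_zero L b l, Ioo_mem_nhdsGT hL] with x hx hxL
  have hs := sin_pos hL hxL
  have hx0 := hxL.1
  have h1 : Real.sin (Real.pi * x / L) ≤ Real.pi * x / L := Real.sin_le (by positivity)
  have h2 : Real.sin (Real.pi * x / L) ^ l ≤ 1 := Real.rpow_le_one hs.le (Real.sin_le_one _) hl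
  rw [groundState_eq hL hxL]
  calc _ ≤ 1 * (Real.pi * x / L) * 2 := by gcongr
    _ = _ := by ring

/-- One factor sin of the ground state cancels the pole of u, and sin^l stays bounded because l ≥ 0.
-/
theorem abs_groundState_mul_logSlope_le_near_zero (hL : 0 < L) (hl : 0 ≤ l) :
    ∃ K, ∀ᶠ x in 𝓝[>] (0 : ℝ), |groundState L b l x * logSlope L b l x| ≤ K := by
  refine ⟨1 * 2 * (Real.pi / L) * ((l + 1) + |b / (l + 1)|), ?_⟩
  filter_upwards [exp_le_two_near_zero L b l, Ioo_mem_nhdsGT hL] with x hx hxL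
  have hs := sin_pos hL hxL
  have h2 : Real.sin (Real.pi * x / L) ^ l ≤ 1 := Real.rpow_le_one hs.le (Real.sin_le_one _) hl
  have e : groundState L b l x * logSlope L b l x = Real.sin (Real.pi * x / L) ^ l
      * Real.exp (-(b * Real.pi * x / (L * (l + 1)))) * (Real.pi / L)
      * ((l + 1) * Real.cos (Real.pi * x / L) - b / (l + 1) * Real.sin (Real.pi * x / L)) := by
    rw [groundState_eq hL hxL, logSlope, Real.cot_eq_cos_div_sin]
    generalize b / (l + 1) = q
    field_simp
  have h3 : |(l + 1) * Real.cos (Real.pi * x / L) - b / (l + 1) * Real.sin (Real.pi * x / L)|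
      ≤ (l + 1) + |b / (l + 1)| := by
    refine (abs_sub _ _).trans (add_le_add ?_ ?_)
    · rw [abs_mul, abs_of_nonneg (by linarith : 0 ≤ l + 1)]
      exact mul_le_of_le_one_right (by linarith) (Real.abs_cos_le_one _)
    · rw [abs_mul]
      exact mul_le_of_le_one_right (abs_nonneg _) (Real.abs_sin_le_one _)
  have := Real.pi_pos
  have h4 : 0 ≤ Real.sin (Real.pi * x / L) ^ l := Real.rpow_nonneg hs.le _
  rw [e, abs_mul, abs_of_nonneg (by positivity)]
  gcongr

/-- The ground state is an integrating factor for the first-order equation of Af, since g' = ug. -/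
theorem IsSol.hasDerivAt_groundState_mul_lower {e : ℂ} {f : ℝ → ℂ} (hf : IsSol L b l e f)
    (hL : 0 < L) (hl : 0 < l + 1) {x : ℝ} (hx : x ∈ Ioo 0 L) :
    HasDerivAt (fun x => (groundState L b l x : ℂ) * lowerOp L b l f x)
      (-((e - level L b l) * (groundState L b l x * f x))) x := by
  convert! (hasDerivAt_groundState hL hx).ofReal_comp.mul (hf.hasDerivAt_lower hL hl hx) using 1
  push_cast
  ring

/-- A function on `(0, δ)` with derivative of size at least `c / x` has no limit at `0`. -/
theorem not_tendsto_of_deriv_ge {r r' : ℝ → ℝ} {c u : ℝ} (hc : 0 < c)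
    (hr : ∀ᶠ x in 𝓝[>] (0 : ℝ), HasDerivAt r (r' x) x)
    (hr' : ∀ᶠ x in 𝓝[>] (0 : ℝ), c / x ≤ r' x) : ¬ Tendsto r (𝓝[>] 0) (𝓝 u) := by
  intro ht
  have hsmall := ht.eventually (Metric.ball_mem_nhds u (show 0 < c / 4 by positivity))
  obtain ⟨δ, hδ, hsub⟩ := mem_nhdsGT_iff_exists_Ioo_subset.mp (hr.and (hr'.and hsmall))
  have hδ0 : (0 : ℝ) < δ := hδ
  have hm : ∀ y ∈ Icc (δ / 4) (2 * (δ / 4)), y ∈ Ioo 0 δ := fun y hy =>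
    ⟨by linarith [hy.1], by linarith [hy.2]⟩
  -- On [δ/4, δ/2] the mean value theorem gives an increment of at least (c/ξ)(δ/4) > c/2, whereas
  -- both end values lie within c/4 of the supposed limit.
  obtain ⟨ξ, hξ, he⟩ := exists_hasDerivAt_eq_slope r r' (a := δ / 4) (b := 2 * (δ / 4))
    (by linarith) (fun y hy => (hsub (hm y hy)).1.continuousAt.continuousWithinAt)
    (fun y hy => (hsub (hm y (Ioo_subset_Icc_self hy))).1)
  have h1 := (hsub (hm ξ (Ioo_subset_Icc_self hξ))).2.1
  have h2 := (hsub (hm (δ / 4) ⟨le_rfl, by linarith⟩)).2.2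
  have h3 := (hsub (hm (2 * (δ / 4)) ⟨by linarith, le_rfl⟩)).2.2
  have h2' : |r (δ / 4) - u| < c / 4 := h2
  have h3' : |r (2 * (δ / 4)) - u| < c / 4 := h3
  rw [he, div_le_div_iff₀ (by linarith [hξ.1]) (by linarith)] at h1
  rw [abs_lt] at h2' h3'
  have h4 : r (2 * (δ / 4)) - r (δ / 4) < c / 2 := by linarith
  have h5 := mul_lt_mul_of_pos_right h4 (show 0 < ξ by linarith [hξ.1])
  nlinarith [hξ.2]

/-- A Lipschitz function is uniformly continuous, so it maps the punctured neighbourhood filter to a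
Cauchy filter. -/
theorem exists_tendsto_of_deriv_bounded {h h' : ℝ → ℂ} {M : ℝ}
    (hd : ∀ᶠ x in 𝓝[>] (0 : ℝ), HasDerivAt h (h' x) x)
    (hM : ∀ᶠ x in 𝓝[>] (0 : ℝ), ‖h' x‖ ≤ M) : ∃ C, Tendsto h (𝓝[>] 0) (𝓝 C) := by
  obtain ⟨δ, hδ, hsub⟩ := mem_nhdsGT_iff_exists_Ioo_subset.mp (hd.and hM)
  have hlip : LipschitzOnWith M.toNNReal h (Ioo 0 δ) :=
    (convex_Ioo 0 δ).lipschitzOnWith_of_nnnorm_hasDerivWithin_le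
      (fun x hx => (hsub hx).1.hasDerivWithinAt) (fun x hx => by
        rw [← NNReal.coe_le_coe, coe_nnnorm]
        exact (hsub hx).2.trans (Real.le_coe_toNNReal M))
  have hcau : Cauchy (map h (𝓝[>] (0 : ℝ))) :=
    (cauchy_nhds.mono nhdsWithin_le_nhds).map_of_le hlip.uniformContinuousOn
      (le_principal_iff.mpr (Ioo_mem_nhdsGT hδ))
  exact cauchy_map_iff_exists_tendsto.mp hcau

/-- The product g·Af has a bounded derivative, hence a limit C. If C ≠ 0, then g f' → C because gu
is bounded and f → 0. As g = O(x), Re(f'/C) is at least a multiple of 1/x, and f would diverge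
logarithmically instead of tending to 0. -/
theorem IsSol.tendsto_groundState_mul_lower {e : ℂ} {f : ℝ → ℂ} (hf : IsSol L b l e f)
    (hL : 0 < L) (hl : 0 ≤ l) :
    Tendsto (fun x => (groundState L b l x : ℂ) * lowerOp L b l f x) (𝓝[>] 0) (𝓝 0) := by
  have hl1 : 0 < l + 1 := by linarith
  have hdom : ∀ᶠ x in 𝓝[>] (0 : ℝ), x ∈ Ioo 0 L := Ioo_mem_nhdsGT hL
  obtain ⟨K, hK⟩ := abs_groundState_mul_logSlope_le_near_zero (b := b) hL hl
  have hfs : ∀ᶠ x in 𝓝[>] (0 : ℝ), ‖f x‖ ≤ 1 := by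
    have := hf.left.norm
    rw [norm_zero] at this
    exact this.eventually (eventually_le_nhds one_pos)
  obtain ⟨C, hC⟩ := exists_tendsto_of_deriv_bounded
    (M := ‖e - level L b l‖ * ((2 * Real.pi / L * L) * 1))
    (hdom.mono fun x hx => hf.hasDerivAt_groundState_mul_lower hL hl1 hx) (by
      filter_upwards [hdom, hfs, groundState_le_near_zero (b := b) hL hl] with x hx h1 h2
      have := Real.pi_pos
      rw [norm_neg, norm_mul, norm_mul, Complex.norm_real, Real.norm_eq_abs,
        abs_of_pos (groundState_pos hL hx)]
      have : groundState L b l x ≤ 2 * Real.pi / L * L :=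
        h2.trans (mul_le_mul_of_nonneg_left hx.2.le (by positivity))
      have := groundState_pos (b := b) (l := l) hL hx
      gcongr)
  by_cases hC0 : C = 0
  · rwa [hC0] at hC
  exfalso
  have h0 : Tendsto (fun x => ((groundState L b l x * logSlope L b l x : ℝ) : ℂ) * f x) (𝓝[>] 0)
      (𝓝 0) := by
    refine Filter.Tendsto.zero_mul_isBoundedUnder_le hf.left ?_ |>.congr fun x => mul_comm _ _
    exact ⟨K, by
      rw [eventually_map]
      filter_upwards [hK] with x hx
      simpa [Complex.norm_real, -Complex.ofReal_mul] using hx⟩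
  have h1 : Tendsto (fun x => ((groundState L b l x : ℂ) * deriv f x / C).re) (𝓝[>] 0)
      (𝓝 1) := by
    have h2 := (hC.add h0).div_const C
    rw [add_zero, div_self hC0] at h2
    have h3 := (Complex.continuous_re.tendsto 1).comp h2
    rw [Complex.one_re] at h3
    refine h3.congr fun x => ?_
    simp only [Function.comp, lowerOp]
    push_cast
    ring_nf
  have hpi := Real.pi_pos
  refine not_tendsto_of_deriv_ge (r := fun x => (f x / C).re) (r' := fun x => (deriv f x / C).re)
    (c := (1 / 2) / (2 * Real.pi / L)) (u := 0) (by positivity) ?_ ?_ ?_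
  · filter_upwards [hdom] with x hx
    exact Complex.reCLM.hasFDerivAt.comp_hasDerivAt x ((hf.diff x hx).hasDerivAt.div_const C)
  · filter_upwards [hdom, groundState_le_near_zero (b := b) hL hl,
      h1.eventually (eventually_ge_nhds (show (1 : ℝ) / 2 < 1 by norm_num))] with x hx h2 h3
    have hg := groundState_pos (b := b) (l := l) hL hx
    rw [mul_div_assoc, Complex.re_ofReal_mul] at h3
    rw [div_div, div_le_iff₀ (by have := hx.1; positivity)]
    -- The sign is needed before the upper bound for g may be inserted into g·Re(f'/C) ≥ 1/2.
    have hr : 0 ≤ (deriv f x / C).re := by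
      by_contra hneg
      push Not at hneg
      nlinarith
    nlinarith
  · have := (Complex.continuous_re.tendsto 0).comp (hf.left.div_const C |>.trans (by simp))
    exact this

/-- Integrating (g·Af)' from 0, where g·Af tends to 0, gives g(x)|Af(x)| ≤ M·x·g(x), since g is
increasing near 0 and f is bounded. Dividing by g(x) leaves |Af(x)| ≤ Mx. -/
theorem IsSol.tendsto_lower_left {e : ℂ} {f : ℝ → ℂ} (hf : IsSol L b l e f)
    (hL : 0 < L) (hl : 0 ≤ l) : Tendsto (lowerOp L b l f) (𝓝[>] 0) (𝓝 0) := by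
  have hl1 : 0 < l + 1 := by linarith
  have hlim := hf.tendsto_groundState_mul_lower hL hl
  obtain ⟨B, hB0, hB⟩ := exists_bound hL hf.continuousOn hf.left hf.right
  obtain ⟨δ, hδ, hsub⟩ := mem_nhdsGT_iff_exists_Ioo_subset.mp
    ((logSlope_nonneg_near_zero (b := b) hL hl).and (Ioo_mem_nhdsGT hL))
  have hmono : MonotoneOn (groundState L b l) (Ioo 0 δ) := by
    refine monotoneOn_of_deriv_nonneg (convex_Ioo _ _) (fun x hx =>
      (hasDerivAt_groundState hL (hsub hx).2).continuousAt.continuousWithinAt) ?_ ?_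
    · intro x hx
      rw [interior_Ioo] at hx
      exact (hasDerivAt_groundState hL (hsub hx).2).differentiableAt.differentiableWithinAt
    · intro x hx
      rw [interior_Ioo] at hx
      rw [(hasDerivAt_groundState hL (hsub hx).2).deriv]
      exact mul_nonneg (hsub hx).1 (groundState_pos hL (hsub hx).2).le
  set M := ‖e - level L b l‖ * B with hM
  have hM0 : 0 ≤ M := by positivity
  have key : ∀ x ∈ Ioo 0 δ, ‖lowerOp L b l f x‖ ≤ M * x := by
    intro x hx
    have hgx := groundState_pos (b := b) (l := l) hL (hsub hx).2
    have h1 : ∀ y ∈ Ioo 0 x, ‖(groundState L b l x : ℂ) * lowerOp L b l f x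
        - groundState L b l y * lowerOp L b l f y‖ ≤ M * groundState L b l x * x := by
      intro y hy
      have hmem : ∀ t ∈ Icc y x, t ∈ Ioo 0 δ := fun t ht =>
        ⟨hy.1.trans_le ht.1, ht.2.trans_lt hx.2⟩
      refine ((convex_Icc y x).norm_image_sub_le_of_norm_hasDerivWithin_le
        (C := M * groundState L b l x)
        (fun t ht => (hf.hasDerivAt_groundState_mul_lower hL hl1
          (hsub (hmem t ht)).2).hasDerivWithinAt) ?_ ⟨le_rfl, hy.2.le⟩ ⟨hy.2.le, le_rfl⟩).trans ?_
      · intro t ht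
        have hgt := groundState_pos (b := b) (l := l) hL (hsub (hmem t ht)).2
        have h2 := hmono (hmem t ht) hx ht.2
        have h3 := hB t (hsub (hmem t ht)).2
        rw [norm_neg, norm_mul, norm_mul, Complex.norm_real, Real.norm_eq_abs, abs_of_pos hgt, hM]
        calc _ ≤ ‖e - level L b l‖ * (groundState L b l x * B) := by gcongr
          _ = _ := by ring
      · rw [Real.norm_eq_abs, abs_of_pos (by linarith [hy.2])]
        have : 0 ≤ M * groundState L b l x := by positivity
        exact mul_le_mul_of_nonneg_left (by linarith [hy.1]) this
    have h2 : ‖(groundState L b l x : ℂ) * lowerOp L b l f x‖ ≤ M * groundState L b l x * x := by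
      have h3 := (hlim.const_sub ((groundState L b l x : ℂ) * lowerOp L b l f x)).norm
      rw [sub_zero] at h3
      refine le_of_tendsto h3 ?_
      filter_upwards [Ioo_mem_nhdsGT hx.1] with y hy using h1 y hy
    rw [norm_mul, Complex.norm_real, Real.norm_eq_abs, abs_of_pos hgx] at h2
    refine le_of_mul_le_mul_left ?_ hgx
    linarith
  refine squeeze_zero_norm' (a := fun x => M * x) ?_ ?_
  · filter_upwards [Ioo_mem_nhdsGT hδ] with x hx using key x hx
  · have : Tendsto (fun x : ℝ => M * x) (𝓝 0) (𝓝 (M * 0)) := by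
      apply Continuous.tendsto; fun_prop
    rw [mul_zero] at this
    exact this.mono_left nhdsWithin_le_nhds

theorem IsSol.tendsto_lower_right {e : ℂ} {f : ℝ → ℂ} (hf : IsSol L b l e f)
    (hL : 0 < L) (hl : 0 ≤ l) : Tendsto (lowerOp L b l f) (𝓝[<] L) (𝓝 0) := by
  have h := (((hf.reflect hL).tendsto_lower_left hL hl).comp (tendsto_reflect_right L)).neg
  rw [neg_zero] at h
  refine h.congr fun x => ?_
  simp [lower_reflect hL.ne']

/-- The lowering operator maps level `l` to level `l + 1`. -/
theorem IsSol.lower {e : ℂ} {f : ℝ → ℂ} (hf : IsSol L b l e f) (hL : 0 < L) (hl : 0 ≤ l) :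
    IsSol L b (l + 1) e (lowerOp L b l f) := by
  have hl1 : 0 < l + 1 := by linarith
  refine ⟨fun x hx => (hf.hasDerivAt_lower hL hl1 hx).differentiableAt, fun x hx => ?_,
    hf.tendsto_lower_left hL hl, hf.tendsto_lower_right hL hl⟩
  have h1 : deriv (lowerOp L b l f) =ᶠ[𝓝 x] fun x =>
      -(logSlope L b l x * lowerOp L b l f x) - (e - level L b l) * f x := by
    filter_upwards [isOpen_Ioo.mem_nhds hx] with y hy using (hf.hasDerivAt_lower hL hl1 hy).deriv
  have h2 := (((hasDerivAt_logSlope (b := b) (l := l) hL hx).ofReal_comp.mul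
    (hf.hasDerivAt_lower hL hl1 hx)).fun_neg).sub
      ((hf.diff x hx).hasDerivAt.const_mul (e - level L b l))
  convert! h2.congr_of_eventuallyEq h1 using 1
  -- The second Riccati equation replaces u² - u' by the potential with parameter l + 1.
  have h3 := congrArg (fun r : ℝ => (r : ℂ)) (logSlope_sq_sub (b := b) hL hl1 hx)
  push_cast at h3 ⊢
  have h4 : deriv f x = lowerOp L b l f x + logSlope L b l x * f x := by
    simp only [lowerOp]; ring
  rw [h4]
  linear_combination -lowerOp L b l f x * h3

/-! ### Norm identity, simplicity and completeness of the levels -/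

/-- The squared norm in `L²(0, L)`. -/
def normSq (L : ℝ) (f : ℝ → ℂ) : ℝ := ∫ x in Ioo 0 L, ‖f x‖ ^ 2

theorem level_lt {l' : ℝ} (hL : 0 < L) (hl : 0 < l + 1) (h : l < l') : level L b l < level L b l' := by
  have h1 : (l + 1) ^ 2 < (l' + 1) ^ 2 := by gcongr
  have h2 : b ^ 2 / (l' + 1) ^ 2 ≤ b ^ 2 / (l + 1) ^ 2 :=
    div_le_div_of_nonneg_left (sq_nonneg b) (by positivity) h1.le
  have : 0 < Real.pi := Real.pi_pos
  unfold level
  exact mul_lt_mul_of_pos_left (by linarith) (by positivity)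

theorem IsSol.integrableOn_norm_sq {e : ℂ} {f : ℝ → ℂ} (hf : IsSol L b l e f) (hL : 0 < L) :
    IntegrableOn (fun x => ‖f x‖ ^ 2) (Ioo 0 L) := by
  obtain ⟨B, hB0, hB⟩ := exists_bound hL hf.continuousOn hf.left hf.right
  refine IntegrableOn.of_bound (by simp)
    ((hf.continuousOn.norm.pow 2).aestronglyMeasurable measurableSet_Ioo) (B ^ 2) ?_
  filter_upwards [ae_restrict_mem measurableSet_Ioo] with x hx
  rw [norm_pow, norm_norm]
  exact pow_le_pow_left₀ (norm_nonneg _) (hB x hx) 2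

theorem IsSol.normSq_pos {e : ℂ} {f : ℝ → ℂ} (hf : IsSol L b l e f) (hL : 0 < L)
    (h : ∃ x ∈ Ioo 0 L, f x ≠ 0) : 0 < normSq L f := by
  obtain ⟨x, hx, hne⟩ := h
  refine (setIntegral_pos_iff_support_of_nonneg_ae (Eventually.of_forall fun x => by positivity)
    (hf.integrableOn_norm_sq hL)).mpr ?_
  have hopen : IsOpen ({y | f y ≠ 0} ∩ Ioo 0 L) := by
    rw [inter_comm]
    exact hf.continuousOn.isOpen_inter_preimage isOpen_Ioo isOpen_ne
  refine (hopen.measure_pos volume ⟨x, hne, hx⟩).trans_le (measure_mono ?_)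
  intro y hy
  exact ⟨by simpa using hy.1, hy.2⟩

/-- The factorization identity `‖A f‖² = (e - level) ‖f‖²`. -/
theorem IsSol.normSq_lower {e : ℂ} {f : ℝ → ℂ} (hf : IsSol L b l e f) (hL : 0 < L) (hl : 0 ≤ l) :
    (normSq L (lowerOp L b l f) : ℂ) = (e - level L b l) * normSq L f := by
  have hl1 : 0 < l + 1 := by linarith
  have hD := hf.lower hL hl
  have hi1 : Integrable (fun x => ((‖lowerOp L b l f x‖ ^ 2 : ℝ) : ℂ))
      (volume.restrict (Ioo 0 L)) := (hD.integrableOn_norm_sq hL).ofReal (𝕜 := ℂ)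
  have hi2 : Integrable (fun x => (e - level L b l) * ((‖f x‖ ^ 2 : ℝ) : ℂ))
      (volume.restrict (Ioo 0 L)) := ((hf.integrableOn_norm_sq hL).ofReal (𝕜 := ℂ)).const_mul (e - level L b l)
  -- The derivative of conj(f)·Af is |Af|² - (e - level)|f|², as u is real; both factors vanish at
  -- both ends, so no boundary terms remain.
  have key := intervalIntegral.integral_eq_sub_of_hasDerivAt_of_tendsto hL
    (f := fun x => (starRingEnd ℂ) (f x) * lowerOp L b l f x)
    (f' := fun x => ((‖lowerOp L b l f x‖ ^ 2 : ℝ) : ℂ)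
      - (e - level L b l) * ((‖f x‖ ^ 2 : ℝ) : ℂ)) (fa := 0) (fb := 0) ?_ ?_ ?_ ?_
  · rw [intervalIntegral.integral_of_le hL.le, integral_Ioc_eq_integral_Ioo, sub_zero] at key
    rw [integral_sub hi1 hi2, integral_const_mul] at key
    rw [normSq, normSq, ← integral_complex_ofReal, ← integral_complex_ofReal]
    exact sub_eq_zero.mp key
  · intro x hx
    have h1 : HasDerivAt (fun x => (starRingEnd ℂ) (f x)) ((starRingEnd ℂ) (deriv f x)) x :=
      (hf.diff x hx).hasDerivAt.star
    convert! h1.mul (hf.hasDerivAt_lower hL hl1 hx) using 1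
    have h4 : deriv f x = lowerOp L b l f x + logSlope L b l x * f x := by
      simp only [lowerOp]; ring
    rw [h4]
    simp only [map_add, map_mul, Complex.conj_ofReal]
    push_cast
    rw [← Complex.conj_mul', ← Complex.conj_mul']
    ring
  · rw [intervalIntegrable_iff_integrableOn_Ioo_of_le hL.le]
    exact hi1.sub hi2
  · have := hf.left.star.mul hD.left
    simpa using this
  · have := hf.right.star.mul hD.right
    simpa using this

/-- Solutions annihilated by the lowering operator are multiples of the ground state. -/
theorem IsSol.eq_const_mul_groundState {e : ℂ} {f : ℝ → ℂ} (hf : IsSol L b l e f) (hL : 0 < L)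
    (h : ∀ x ∈ Ioo 0 L, lowerOp L b l f x = 0) :
    ∃ c : ℂ, ∀ x ∈ Ioo 0 L, f x = c * groundState L b l x := by
  have hd : ∀ x ∈ Ioo 0 L, HasDerivAt (fun x => f x / (groundState L b l x : ℂ)) 0 x := by
    intro x hx
    have hg : (groundState L b l x : ℂ) ≠ 0 := by exact_mod_cast (groundState_pos hL hx).ne'
    have h1 := (hf.diff x hx).hasDerivAt.fun_div (hasDerivAt_groundState hL hx).ofReal_comp hg
    convert! h1 using 1
    have h2 := h x hx
    simp only [lowerOp] at h2
    rw [sub_eq_zero.mp h2]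
    push_cast
    ring
  obtain ⟨c, hc⟩ := isOpen_Ioo.exists_is_const_of_deriv_eq_zero isPreconnected_Ioo
    (fun x hx => (hd x hx).differentiableAt.differentiableWithinAt) (fun x hx => (hd x hx).deriv)
  refine ⟨c, fun x hx => ?_⟩
  have hg : (groundState L b l x : ℂ) ≠ 0 := by exact_mod_cast (groundState_pos hL hx).ne'
  rw [← hc x hx, div_mul_cancel₀ _ hg]

/-- If Af vanishes identically, its first-order equation reduces to (e - level) f = 0. So A is
injective away from the ground level. -/
theorem IsSol.eq_zero_of_lower_eq_zero {e : ℂ} {f : ℝ → ℂ} (hf : IsSol L b l e f) (hL : 0 < L)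
    (hl : 0 < l + 1) (he : e ≠ level L b l) (h : ∀ x ∈ Ioo 0 L, lowerOp L b l f x = 0) :
    ∀ x ∈ Ioo 0 L, f x = 0 := by
  intro x hx
  have h1 := hf.hasDerivAt_lower hL hl hx
  have h2 : HasDerivAt (lowerOp L b l f) 0 x := by
    refine (hasDerivAt_const x (0 : ℂ)).congr_of_eventuallyEq ?_
    filter_upwards [isOpen_Ioo.mem_nhds hx] with y hy using h y hy
  have h3 := h1.unique h2
  rw [h x hx, mul_zero, neg_zero, zero_sub, neg_eq_zero] at h3
  exact (mul_eq_zero.mp h3).resolve_left (sub_ne_zero.mpr he)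

theorem lower_sub_const_mul {f g : ℝ → ℂ} {x : ℝ} (hf : DifferentiableAt ℝ f x)
    (hg : DifferentiableAt ℝ g x) (c : ℂ) :
    lowerOp L b l (fun x => g x - c * f x) x
      = lowerOp L b l g x - c * lowerOp L b l f x := by
  simp only [lowerOp]
  rw [(hg.hasDerivAt.fun_sub (hf.hasDerivAt.const_mul c)).deriv]
  ring

/-- All energy levels are simple. -/
theorem IsSol.exists_eq_const_mul (hL : 0 < L) (n : ℕ) : ∀ {l : ℝ} {f g : ℝ → ℂ}, 0 ≤ l →
    IsSol L b l (level L b (l + n)) f → IsSol L b l (level L b (l + n)) g →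
    (∃ x ∈ Ioo 0 L, f x ≠ 0) → ∃ c : ℂ, ∀ x ∈ Ioo 0 L, g x = c * f x := by
  induction n with
  | zero =>
    intro l f g hl hf hg hne
    rw [Nat.cast_zero, add_zero] at hf hg
    have hz : ∀ f : ℝ → ℂ, IsSol L b l (level L b l) f →
        ∃ c : ℂ, ∀ x ∈ Ioo 0 L, f x = c * groundState L b l x := by
      intro f hf
      -- At the ground level the norm identity gives ‖Af‖² = 0.
      refine hf.eq_const_mul_groundState hL ?_
      have h1 := hf.normSq_lower hL hl
      rw [sub_self, zero_mul, Complex.ofReal_eq_zero] at h1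
      by_contra! h2
      exact ((hf.lower hL hl).normSq_pos hL h2).ne' h1
    obtain ⟨c, hc⟩ := hz f hf
    obtain ⟨d, hd⟩ := hz g hg
    have hc0 : c ≠ 0 := by
      rintro rfl
      obtain ⟨x, hx, hne⟩ := hne
      exact hne (by rw [hc x hx, zero_mul])
    refine ⟨d / c, fun x hx => ?_⟩
    rw [hd x hx, hc x hx]
    field_simp
  | succ n ih =>
    intro l f g hl hf hg hne
    have hl1 : 0 < l + 1 := by linarith
    have he : ((level L b (l + (n + 1 : ℕ)) : ℝ) : ℂ) ≠ level L b l := by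
      have : level L b l < level L b (l + (n + 1 : ℕ)) :=
        level_lt hL hl1 (by push_cast; linarith [n.cast_nonneg (α := ℝ)])
      exact_mod_cast this.ne'
    have e1 : l + ((n + 1 : ℕ) : ℝ) = l + 1 + n := by push_cast; ring
    have hDf := hf.lower hL hl
    have hDg := hg.lower hL hl
    rw [e1] at hDf hDg
    have hDne : ∃ x ∈ Ioo 0 L, lowerOp L b l f x ≠ 0 := by
      by_contra! h
      obtain ⟨x, hx, hne⟩ := hne
      exact hne (hf.eq_zero_of_lower_eq_zero hL hl1 he h x hx)
    obtain ⟨c, hc⟩ := ih (by linarith) hDf hDg hDne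
    refine ⟨c, fun x hx => ?_⟩
    -- The relation Ag = c·Af one step down the ladder lifts to g = cf because A is injective at
    -- this energy.
    refine sub_eq_zero.mp ((hg.sub_const_mul hf c).eq_zero_of_lower_eq_zero hL hl1 he ?_ x hx)
    intro y hy
    rw [lower_sub_const_mul (hf.diff y hy) (hg.diff y hy), hc y hy, sub_self]

/-- The norm identity exhibits e - level as ‖Af‖²/‖f‖². -/
theorem IsSol.exists_real {e : ℂ} {f : ℝ → ℂ} (hf : IsSol L b l e f) (hL : 0 < L) (hl : 0 ≤ l)
    (hne : ∃ x ∈ Ioo 0 L, f x ≠ 0) : ∃ r : ℝ, e = r ∧ level L b l ≤ r := by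
  have h1 := hf.normSq_lower hL hl
  have h2 := hf.normSq_pos hL hne
  have h3 : (normSq L f : ℂ) ≠ 0 := by exact_mod_cast h2.ne'
  have h4 : 0 ≤ normSq L (lowerOp L b l f) := integral_nonneg fun x => by positivity
  refine ⟨level L b l + normSq L (lowerOp L b l f) / normSq L f, ?_, ?_⟩
  · push_cast
    rw [h1, mul_div_cancel_right₀ _ h3]
    ring
  · have := div_nonneg h4 h2.le
    linarith

/-- Each lowering raises the ground level and keeps e. Unless e meets one of these levels, N
lowerings leave a nonzero solution below its own ground level, which is impossible. -/
theorem IsSol.exists_level_of_lt (hL : 0 < L) (N : ℕ) : ∀ {l : ℝ} {e : ℝ} {f : ℝ → ℂ}, 0 ≤ l →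
    IsSol L b l e f → (∃ x ∈ Ioo 0 L, f x ≠ 0) → e < level L b (l + N) →
    ∃ n : ℕ, e = level L b (l + n) := by
  induction N with
  | zero =>
    intro l e f hl hf hne hlt
    obtain ⟨r, hr, hle⟩ := hf.exists_real hL hl hne
    rw [Complex.ofReal_inj] at hr
    rw [Nat.cast_zero, add_zero] at hlt
    linarith
  | succ N ih =>
    intro l e f hl hf hne hlt
    by_cases he : e = level L b l
    · exact ⟨0, by simpa using he⟩
    have hDne : ∃ x ∈ Ioo 0 L, lowerOp L b l f x ≠ 0 := by
      by_contra! h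
      obtain ⟨x, hx, hne⟩ := hne
      exact hne (hf.eq_zero_of_lower_eq_zero hL (by linarith) (by exact_mod_cast he) h x hx)
    have e1 : l + ((N + 1 : ℕ) : ℝ) = l + 1 + N := by push_cast; ring
    rw [e1] at hlt
    obtain ⟨n, hn⟩ := ih (by linarith) (hf.lower hL hl) hDne hlt
    exact ⟨n + 1, by rw [hn]; congr 1; push_cast; ring⟩

/-- The energy levels are the numbers `level (l + n)`. -/
theorem IsSol.exists_level {e : ℂ} {f : ℝ → ℂ} (hf : IsSol L b l e f) (hL : 0 < L) (hl : 0 ≤ l)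
    (hne : ∃ x ∈ Ioo 0 L, f x ≠ 0) : ∃ n : ℕ, e = level L b (l + n) := by
  obtain ⟨r, rfl, -⟩ := hf.exists_real hL hl hne
  have hpi : 0 < (Real.pi / L) ^ 2 := by have := Real.pi_pos; positivity
  -- This N suffices since level (l + N) ≥ (π/L)² (N - b²).
  obtain ⟨N, hN⟩ := exists_nat_gt (r / (Real.pi / L) ^ 2 + b ^ 2)
  obtain ⟨n, hn⟩ := IsSol.exists_level_of_lt hL N hl hf hne (by
    have h1 : b ^ 2 / (l + N + 1) ^ 2 ≤ b ^ 2 :=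
      div_le_self (sq_nonneg b) (one_le_pow₀ (by linarith [N.cast_nonneg (α := ℝ)]))
    have h2 : (N : ℝ) ≤ (l + N + 1) ^ 2 := by nlinarith [N.cast_nonneg (α := ℝ)]
    have h3 : r / (Real.pi / L) ^ 2 < (l + N + 1) ^ 2 - b ^ 2 / (l + N + 1) ^ 2 := by linarith
    rw [div_lt_iff₀ hpi] at h3
    rw [level]
    linarith)
  exact ⟨n, by exact_mod_cast hn⟩

end CotWell

/-! ### Jacobi polynomials: coefficients, differential equation, derivative -/

section Jacobi

open Polynomial

/-- The Jacobi polynomial as a polynomial in the variable `(z - 1) / 2`. -/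
def jacobiPoly (n : ℕ) (a b : ℂ) : ℂ[X] :=
  ∑ k ∈ Finset.range (n + 1), monomial k ((1 / (n.factorial : ℂ)) * ((n.choose k : ℂ)
    * (ascPochhammer ℂ (n - k)).eval (a + k + 1) * (ascPochhammer ℂ k).eval (n + a + b + 1)))

theorem jacobiP_eq_eval (n : ℕ) (a b z : ℂ) :
    jacobiP n a b z = (jacobiPoly n a b).eval ((z - 1) / 2) := by
  simp only [jacobiP, jacobiPoly, eval_finsetSum, eval_monomial, Finset.mul_sum, mul_assoc]

theorem coeff_jacobiPoly (n : ℕ) (a b : ℂ) (k : ℕ) :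
    (jacobiPoly n a b).coeff k = (1 / (n.factorial : ℂ)) * ((n.choose k : ℂ)
      * (ascPochhammer ℂ (n - k)).eval (a + k + 1)
      * (ascPochhammer ℂ k).eval (n + a + b + 1)) := by
  simp only [jacobiPoly, finsetSum_coeff, coeff_monomial, Finset.sum_ite_eq', Finset.mem_range]
  split_ifs with h
  · rfl
  · rw [Nat.choose_eq_zero_of_lt (by omega)]
    simp

theorem ascPochhammer_eval_succ_left (m : ℕ) (x : ℂ) :
    (ascPochhammer ℂ (m + 1)).eval x = x * (ascPochhammer ℂ m).eval (x + 1) := by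
  simp [ascPochhammer_succ_left]

theorem ascPochhammer_eval_succ_right (m : ℕ) (x : ℂ) :
    (ascPochhammer ℂ (m + 1)).eval x = (ascPochhammer ℂ m).eval x * (x + m) := by
  simp [ascPochhammer_succ_right]

/-- This is the Jacobi equation read coefficientwise. Both sides are multiplied out, so it holds for
all complex a and b. -/
theorem coeff_jacobiPoly_succ (n : ℕ) (a b : ℂ) (k : ℕ) :
    (k + 1) * (a + k + 1) * (jacobiPoly n a b).coeff (k + 1)
      = (n - k) * (n + a + b + 1 + k) * (jacobiPoly n a b).coeff k := by
  rw [coeff_jacobiPoly, coeff_jacobiPoly]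
  rcases lt_or_ge k n with h | h
  · obtain ⟨m, rfl⟩ : ∃ m, n = k + 1 + m := ⟨n - (k + 1), by omega⟩
    have h1 := congrArg (fun r : ℕ => (r : ℂ)) (Nat.choose_succ_right_eq (k + 1 + m) k)
    have e1 : k + 1 + m - k = m + 1 := by omega
    have e2 : k + 1 + m - (k + 1) = m := by omega
    rw [e1] at h1 ⊢
    rw [e2, ascPochhammer_eval_succ_left m, ascPochhammer_eval_succ_right k]
    push_cast at h1 ⊢
    rw [show a + (k + 1 : ℂ) + 1 = a + k + 1 + 1 by ring]
    linear_combination (a + k + 1) * (1 / ((k + 1 + m).factorial : ℂ))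
      * (ascPochhammer ℂ m).eval (a + k + 1 + 1) * (ascPochhammer ℂ k).eval (k + 1 + m + a + b + 1)
      * (k + 1 + m + a + b + 1 + k) * h1
  -- Beyond the degree both sides vanish: for k = n through the factor n - k, for k > n through the
  -- binomial coefficient.
  · rw [Nat.choose_eq_zero_of_lt (by omega : n < k + 1)]
    rcases h.eq_or_lt with rfl | h
    · simp
    · rw [Nat.choose_eq_zero_of_lt h]
      simp

/-- The Jacobi differential equation. -/
theorem jacobiPoly_ode (n : ℕ) (a b : ℂ) :
    X * (1 + X) * derivative (derivative (jacobiPoly n a b))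
      + (C (a + 1) + C (a + b + 2) * X) * derivative (jacobiPoly n a b)
      - C (n * (n + a + b + 1)) * jacobiPoly n a b = 0 := by
  have e : ∀ P : ℂ[X], X * (1 + X) * derivative (derivative P)
      + (C (a + 1) + C (a + b + 2) * X) * derivative P - C (n * (n + a + b + 1)) * P
      = X * derivative (derivative P) + X * (X * derivative (derivative P))
        + C (a + 1) * derivative P + C (a + b + 2) * (X * derivative P)
        - C (n * (n + a + b + 1)) * P := fun P => by ring
  rw [e]
  ext k
  have h := coeff_jacobiPoly_succ n a b k
  -- The coefficients of w^0 and w^1 are separate cases because the leading term carries the factors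
  -- w and w².
  rcases k with _ | _ | k <;>
    simp only [coeff_sub, coeff_add, coeff_C_mul, mul_coeff_zero, coeff_X_zero, coeff_X_mul,
      coeff_derivative, coeff_zero, coeff_C_zero] <;> push_cast at h ⊢ <;> linear_combination h

/-- The derivative is taken in w = (z-1)/2, so the usual factor 1/2 is absent. -/
theorem derivative_jacobiPoly_succ (n : ℕ) (a b : ℂ) :
    derivative (jacobiPoly (n + 1) a b) = C (n + a + b + 2) * jacobiPoly n (a + 1) (b + 1) := by
  ext k
  rw [coeff_derivative, coeff_C_mul, coeff_jacobiPoly, coeff_jacobiPoly,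
    ascPochhammer_eval_succ_left k, Nat.add_sub_add_right, Nat.factorial_succ]
  have h1 := congrArg (fun r : ℕ => (r : ℂ)) (Nat.add_one_mul_choose_eq n k)
  have hf : (n.factorial : ℂ) ≠ 0 := by exact_mod_cast n.factorial_ne_zero
  have hn : (n : ℂ) + 1 ≠ 0 := by exact_mod_cast n.succ_ne_zero
  push_cast at h1 ⊢
  rw [show a + (k + 1 : ℂ) + 1 = a + 1 + k + 1 by ring,
    show (n : ℂ) + 1 + a + b + 1 = n + a + b + 2 by ring,
    show (n : ℂ) + (a + 1) + (b + 1) + 1 = n + a + b + 2 + 1 by ring]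
  field_simp
  linear_combination -(eval (a + 1 + k + 1) (ascPochhammer ℂ (n - k)))
    * (n + a + b + 2) * (eval (n + a + b + 2 + 1) (ascPochhammer ℂ k)) * h1

end Jacobi

/-! ### The explicit functions solve the Dirichlet problem -/

namespace PoschlTeller

open CotWell

variable (p : PoschlTeller)

/-- The variable `(i cot(πx/L) - 1)/2` of the Jacobi polynomials. -/
def jacobiVar (x : ℝ) : ℂ := (Complex.I * (Real.cot (Real.pi * x / p.L) : ℝ) - 1) / 2

/-- The eigenfunction `φ_n` without its normalization constant. -/
def psi (n : ℕ) (x : ℝ) : ℂ :=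
  (groundState p.L p.beta (p.nu + n) x : ℂ)
    * (jacobiPoly n (p.an n) (starRingEnd ℂ (p.an n))).eval (p.jacobiVar x)

theorem phi0_eq (n : ℕ) (x : ℝ) : p.phi0 n x = p.Kn n * p.psi n x := by
  rw [phi0, psi, jacobiP_eq_eval, jacobiVar, groundState, mul_assoc (p.Kn n), Complex.ofReal_mul,
    mul_assoc]

variable {p}

theorem hasDerivAt_jacobiVar (hL : 0 < p.L) {x : ℝ} (hx : x ∈ p.dom) :
    HasDerivAt p.jacobiVar
      (-(Complex.I / 2) * ((Real.pi / p.L / Real.sin (Real.pi * x / p.L) ^ 2 : ℝ) : ℂ)) x := by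
  have h := (((hasDerivAt_cot hL hx).ofReal_comp.const_mul Complex.I).sub_const 1).div_const 2
  convert! h using 1
  push_cast
  ring

theorem conj_an (n : ℕ) :
    starRingEnd ℂ (p.an n) = -(n + p.nu + 1) - Complex.I * p.bn n := by
  simp [an, Complex.ext_iff]

theorem hasDerivAt_eval_jacobiVar (hL : 0 < p.L) (P : Polynomial ℂ) {x : ℝ} (hx : x ∈ p.dom) :
    HasDerivAt (fun x => P.eval (p.jacobiVar x)) ((Polynomial.derivative P).eval (p.jacobiVar x)
      * (-(Complex.I / 2) * ((Real.pi / p.L / Real.sin (Real.pi * x / p.L) ^ 2 : ℝ) : ℂ))) x :=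
  (P.hasDerivAt (p.jacobiVar x)).comp x (hasDerivAt_jacobiVar hL hx)

theorem hasDerivAt_psi (hL : 0 < p.L) (n : ℕ) {x : ℝ} (hx : x ∈ p.dom) :
    HasDerivAt (p.psi n) (logSlope p.L p.beta (p.nu + n) x * p.psi n x
      + groundState p.L p.beta (p.nu + n) x
        * ((Polynomial.derivative (jacobiPoly n (p.an n) (starRingEnd ℂ (p.an n)))).eval
          (p.jacobiVar x) * (-(Complex.I / 2)
          * ((Real.pi / p.L / Real.sin (Real.pi * x / p.L) ^ 2 : ℝ) : ℂ)))) x := by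
  convert! (hasDerivAt_groundState hL hx).ofReal_comp.mul (hasDerivAt_eval_jacobiVar hL _ hx) using 1
  rw [psi]
  push_cast
  ring

/-- Write ψ = g·P(w) with g the ground state for ν + n. The Riccati equation for ν + n handles g''.
As w(1+w) = -1/(4 sin²), w'² is (π/L)²/sin² times w(1+w), and a_n is such that the P' terms also fit
the Jacobi equation. Its constant n(n + a + ā + 1) = -n(n + 2ν + 1) accounts exactly for the
difference of the potentials for ν + n and ν. -/
theorem hasDerivAt_deriv_psi (hL : 0 < p.L) (hnu : 0 ≤ p.nu) (n : ℕ) {x : ℝ} (hx : x ∈ p.dom) :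
    HasDerivAt (deriv (p.psi n))
      ((pot p.L p.beta p.nu x - level p.L p.beta (p.nu + n)) * p.psi n x) x := by
  set P := jacobiPoly n (p.an n) (starRingEnd ℂ (p.an n)) with hP
  set N : ℝ := p.nu + n with hN
  have hN1 : 0 < N + 1 := by positivity
  have hs := sin_pos hL hx
  have hev : deriv (p.psi n) =ᶠ[𝓝 x] fun x => logSlope p.L p.beta N x * p.psi n x
      + groundState p.L p.beta N x * ((Polynomial.derivative P).eval (p.jacobiVar x)
        * (-(Complex.I / 2) * ((Real.pi / p.L / Real.sin (Real.pi * x / p.L) ^ 2 : ℝ) : ℂ))) := by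
    filter_upwards [isOpen_Ioo.mem_nhds hx] with y hy using (hasDerivAt_psi hL n hy).deriv
  have h1 : HasDerivAt (fun x => Real.pi / p.L / Real.sin (Real.pi * x / p.L) ^ 2)
      (-2 * (Real.pi / p.L) ^ 2 * Real.cot (Real.pi * x / p.L)
        / Real.sin (Real.pi * x / p.L) ^ 2) x := by
    have := ((hasDerivAt_angle p.L x).sin.pow 2).fun_inv (pow_ne_zero 2 hs.ne')
    have := this.const_mul (Real.pi / p.L)
    convert! this using 1
    rw [Real.cot_eq_cos_div_sin]
    simp only [Pi.pow_apply]
    field_simp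
    ring
  have h2 := ((hasDerivAt_logSlope (b := p.beta) (l := N) hL hx).ofReal_comp.mul
    (hasDerivAt_psi hL n hx)).add
    ((hasDerivAt_groundState (b := p.beta) (l := N) hL hx).ofReal_comp.mul
      ((hasDerivAt_eval_jacobiVar hL (Polynomial.derivative P) hx).mul
        (h1.ofReal_comp.const_mul (-(Complex.I / 2)))))
  convert! h2.congr_of_eventuallyEq hev using 1
  have hode := congrArg (Polynomial.eval (p.jacobiVar x))
    (jacobiPoly_ode n (p.an n) (starRingEnd ℂ (p.an n)))
  rw [← hP] at hode
  simp only [Polynomial.eval_add, Polynomial.eval_sub, Polynomial.eval_mul, Polynomial.eval_C,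
    Polynomial.eval_X, Polynomial.eval_one, Polynomial.eval_zero, conj_an] at hode
  have hric := congrArg (fun r : ℝ => (r : ℂ)) (logSlope_sq_add (b := p.beta) hL hN1 hx)
  have hcot := congrArg (fun r : ℝ => (r : ℂ)) (cot_sq hL hx)
  have hpot : pot p.L p.beta N x - pot p.L p.beta p.nu x
      = (Real.pi / p.L) ^ 2 / Real.sin (Real.pi * x / p.L) ^ 2 * (n * (2 * p.nu + n + 1)) := by
    simp only [pot, hN]
    field_simp
    ring
  have hpot' := congrArg (fun r : ℝ => (r : ℂ)) hpot
  have hbn : p.beta / (N + 1) = p.bn n := by rw [bn, hN]; congr 1; ring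
  have hsl : logSlope p.L p.beta N x
      = Real.pi / p.L * ((N + 1) * Real.cot (Real.pi * x / p.L) - p.bn n) := by
    rw [logSlope, hbn]
  have hNc : (N : ℂ) = p.nu + n := by rw [hN]; push_cast; ring
  simp only [Pi.mul_apply, psi, ← hP, ← hN]
  have hw : p.jacobiVar x = (Complex.I * (Real.cot (Real.pi * x / p.L) : ℝ) - 1) / 2 := rfl
  generalize hQ0 : P.eval (p.jacobiVar x) = Q0 at *
  generalize hQ1 : (Polynomial.derivative P).eval (p.jacobiVar x) = Q1 at *
  generalize hQ2 : (Polynomial.derivative (Polynomial.derivative P)).eval (p.jacobiVar x) = Q2 at *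
  rw [hw] at hode
  simp only [an] at hode
  simp only [div_eq_mul_inv _ (Real.sin (Real.pi * x / p.L) ^ 2)] at hric hpot' hcot ⊢
  rw [hsl] at hric ⊢
  generalize (Real.sin (Real.pi * x / p.L) ^ 2)⁻¹ = S at *
  generalize Real.cot (Real.pi * x / p.L) = c at *
  generalize Real.pi / p.L = k at *
  generalize groundState p.L p.beta N x = g
  push_cast at hric hpot' hcot hode ⊢
  rw [hNc] at hric ⊢
  linear_combination -(g : ℂ) * (Q0 * hric + Q0 * hpot' + k ^ 2 * S * hode
    + k ^ 2 * S * Q2 / 4 * Complex.I_sq - k ^ 2 * S * Q2 / 4 * Complex.I ^ 2 * hcot)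

theorem norm_jacobiVar (hL : 0 < p.L) {x : ℝ} (hx : x ∈ p.dom) :
    ‖p.jacobiVar x‖ = 1 / (2 * Real.sin (Real.pi * x / p.L)) := by
  have hs := sin_pos hL hx
  have h1 := cot_sq hL hx
  have h2 : ‖p.jacobiVar x‖ ^ 2 = (1 / (2 * Real.sin (Real.pi * x / p.L))) ^ 2 := by
    rw [← Complex.normSq_eq_norm_sq, jacobiVar, Complex.normSq_div, Complex.normSq_apply]
    generalize Real.cot (Real.pi * x / p.L) = c at h1 ⊢
    simp only [Complex.sub_re, Complex.mul_re, Complex.I_re, Complex.ofReal_re, Complex.I_im,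
      Complex.ofReal_im, Complex.one_re, Complex.sub_im, Complex.mul_im, Complex.one_im,
      Complex.normSq_ofNat]
    have h3 : (0 * c - 1 * 0 - 1) * (0 * c - 1 * 0 - 1) + (0 * 0 + 1 * c - 0) * (0 * 0 + 1 * c - 0)
        = 1 / Real.sin (Real.pi * x / p.L) ^ 2 := by linear_combination h1
    rw [h3]
    field_simp
  rwa [pow_left_inj₀ (norm_nonneg _) (by positivity) two_ne_zero] at h2

/-- Since |w| = 1/(2 sin), the term of degree k ≤ n costs at most sin^{-k}, while the prefactor is
at most sin^{n+1}; one factor sin always survives. -/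
theorem exists_norm_psi_le (hL : 0 < p.L) (hnu : 0 ≤ p.nu) (hbeta : 0 ≤ p.beta) (n : ℕ) :
    ∃ M, ∀ x ∈ p.dom, ‖p.psi n x‖ ≤ M * Real.sin (Real.pi * x / p.L) := by
  set P := jacobiPoly n (p.an n) (starRingEnd ℂ (p.an n)) with hP
  refine ⟨∑ k ∈ Finset.range (n + 1), ‖P.coeff k‖, fun x hx => ?_⟩
  have hs := sin_pos hL hx
  have hs1 := Real.sin_le_one (Real.pi * x / p.L)
  have hdeg : P.natDegree < n + 1 := by
    rw [Nat.lt_succ_iff, Polynomial.natDegree_le_iff_coeff_eq_zero]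
    intro k hk
    rw [hP, coeff_jacobiPoly, Nat.choose_eq_zero_of_lt hk]
    simp
  have hx0 := hx.1
  have hN : 0 < p.nu + n + 1 := by positivity
  have hexp : Real.exp (-(p.beta * Real.pi * x / (p.L * (p.nu + n + 1)))) ≤ 1 := by
    rw [Real.exp_le_one_iff, neg_nonpos]
    have := Real.pi_pos
    positivity
  have hg : groundState p.L p.beta (p.nu + n) x ≤ Real.sin (Real.pi * x / p.L) ^ (n + 1) := by
    have h1 : Real.sin (Real.pi * x / p.L) ^ (p.nu + n + 1)
        ≤ Real.sin (Real.pi * x / p.L) ^ ((n + 1 : ℕ) : ℝ) :=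
      Real.rpow_le_rpow_of_exponent_ge hs hs1 (by push_cast; linarith)
    rw [Real.rpow_natCast] at h1
    exact (mul_le_mul h1 hexp (Real.exp_pos _).le (by positivity)).trans_eq (mul_one _)
  rw [psi, ← hP, norm_mul, Complex.norm_real, Real.norm_eq_abs, abs_of_pos (groundState_pos hL hx),
    Polynomial.eval_eq_sum_range' hdeg]
  calc _ ≤ Real.sin (Real.pi * x / p.L) ^ (n + 1)
        * ∑ k ∈ Finset.range (n + 1), ‖P.coeff k * p.jacobiVar x ^ k‖ := by
        gcongr
        exact norm_sum_le _ _
    _ = ∑ k ∈ Finset.range (n + 1), ‖P.coeff k‖ * (Real.sin (Real.pi * x / p.L) ^ (n + 1)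
          * (1 / (2 * Real.sin (Real.pi * x / p.L))) ^ k) := by
        rw [Finset.mul_sum]
        refine Finset.sum_congr rfl fun k _ => ?_
        rw [norm_mul, norm_pow, norm_jacobiVar hL hx]
        ring
    _ ≤ ∑ k ∈ Finset.range (n + 1), ‖P.coeff k‖ * Real.sin (Real.pi * x / p.L) := by
        refine Finset.sum_le_sum fun k hk => ?_
        gcongr
        have hk' : k ≤ n := by simpa [Nat.lt_succ_iff] using hk
        obtain ⟨m, rfl⟩ := Nat.exists_eq_add_of_le hk'
        have e : Real.sin (Real.pi * x / p.L) ^ (k + m + 1)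
            * (1 / (2 * Real.sin (Real.pi * x / p.L))) ^ k
            = Real.sin (Real.pi * x / p.L) * (Real.sin (Real.pi * x / p.L) ^ m * (1 / 2) ^ k) := by
          rw [pow_succ, pow_add, div_pow, mul_pow, div_pow]
          field_simp
        rw [e]
        refine mul_le_of_le_one_right hs.le (mul_le_one₀ (pow_le_one₀ hs.le hs1) (by positivity) ?_)
        exact pow_le_one₀ (by norm_num) (by norm_num)
    _ = _ := by rw [Finset.sum_mul]

theorem isSol_psi (hL : 0 < p.L) (hnu : 0 ≤ p.nu) (hbeta : 0 ≤ p.beta) (n : ℕ) :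
    IsSol p.L p.beta p.nu (level p.L p.beta (p.nu + n)) (p.psi n) := by
  obtain ⟨M, hM⟩ := exists_norm_psi_le hL hnu hbeta n
  have hc : Continuous fun x : ℝ => M * Real.sin (Real.pi * x / p.L) := by fun_prop
  refine ⟨fun x hx => (hasDerivAt_psi hL n hx).differentiableAt,
    fun x hx => hasDerivAt_deriv_psi hL hnu n hx, ?_, ?_⟩
  · refine squeeze_zero_norm' ?_ ((hc.tendsto' 0 0 (by simp)).mono_left nhdsWithin_le_nhds)
    filter_upwards [Ioo_mem_nhdsGT hL] with x hx using hM x hx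
  · refine squeeze_zero_norm' ?_ ((hc.tendsto' p.L 0 (by
      rw [mul_div_assoc, div_self hL.ne']; simp)).mono_left nhdsWithin_le_nhds)
    filter_upwards [Ioo_mem_nhdsLT hL] with x hx using hM x hx

/-- The leading coefficient (-n-2ν-1)_n / n! could vanish only if n + 2ν + 1 were an integer below
n. -/
theorem jacobiPoly_an_ne_zero (hnu : 0 ≤ p.nu) (n : ℕ) :
    jacobiPoly n (p.an n) (starRingEnd ℂ (p.an n)) ≠ 0 := by
  intro h
  have h1 := congrArg (fun P => Polynomial.coeff P n) h
  simp only [coeff_jacobiPoly, Polynomial.coeff_zero, Nat.choose_self, Nat.cast_one, one_mul,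
    Nat.sub_self, ascPochhammer_zero, Polynomial.eval_one] at h1
  have hf : (n.factorial : ℂ) ≠ 0 := by exact_mod_cast n.factorial_ne_zero
  have h2 := (mul_eq_zero.mp h1).resolve_left (one_div_ne_zero hf)
  rw [ascPochhammer_eval_eq_zero_iff] at h2
  obtain ⟨k, hk, h3⟩ := h2
  rw [conj_an, an] at h3
  have h4 := congrArg Complex.re h3
  simp at h4
  have : (k : ℝ) < n := by exact_mod_cast hk
  linarith

/-- The cotangent is injective on the interval, so a vanishing ψ would give the polynomial
infinitely many roots. -/
theorem exists_psi_ne_zero (hL : 0 < p.L) (hnu : 0 ≤ p.nu) (n : ℕ) :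
    ∃ x ∈ Ioo 0 p.L, p.psi n x ≠ 0 := by
  by_contra! h
  refine jacobiPoly_an_ne_zero hnu n (Polynomial.eq_zero_of_infinite_isRoot _ ?_)
  have hinj : InjOn p.jacobiVar (Ioo 0 p.L) := by
    have hc : StrictAntiOn (fun x => Real.cot (Real.pi * x / p.L)) (Ioo 0 p.L) := by
      refine strictAntiOn_of_deriv_neg (convex_Ioo _ _)
        (fun x hx => (hasDerivAt_cot hL hx).continuousAt.continuousWithinAt) fun x hx => ?_
      rw [interior_Ioo] at hx
      rw [(hasDerivAt_cot hL hx).deriv]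
      have := sin_pos hL hx
      have := Real.pi_pos
      exact div_neg_of_neg_of_pos (neg_lt_zero.mpr (by positivity)) (by positivity)
    intro x hx y hy hxy
    apply hc.injOn hx hy
    have := congrArg Complex.im hxy
    simpa [jacobiVar, -Complex.ofReal_cot] using this
  refine ((Ioo_infinite hL).image hinj).mono ?_
  rintro _ ⟨x, hx, rfl⟩
  have h1 := h x hx
  rw [psi] at h1
  exact (mul_eq_zero.mp h1).resolve_left (by exact_mod_cast (groundState_pos hL hx).ne')

end PoschlTeller

/-! ### Hypergeometric form and the normalization constant -/

section Jacobi

open Polynomial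

theorem choose_mul_neg_one_pow {n k : ℕ} (hk : k ≤ n) :
    (n.choose k : ℂ) * (-1) ^ k * k.factorial = (ascPochhammer ℂ k).eval (-(n : ℂ)) := by
  induction k with
  | zero => simp
  | succ k ih =>
    have h1 := congrArg (fun r : ℕ => (r : ℂ)) (Nat.choose_succ_right_eq n k)
    rw [ascPochhammer_eval_succ_right, ← ih (by omega), Nat.factorial_succ, pow_succ]
    push_cast [Nat.cast_sub (show k ≤ n by omega)] at h1 ⊢
    linear_combination -((-1 : ℂ) ^ k * k.factorial) * h1

/-- The splitting (a+1)_n = (a+1)_k (a+1+k)_{n-k} allows (a+1)_n to be taken out, provided no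
(a+1)_k vanishes. -/
theorem jacobiPoly_eval_eq_hypergeometric {n : ℕ} {a b : ℂ}
    (ha : ∀ k ≤ n, (ascPochhammer ℂ k).eval (a + 1) ≠ 0) (w : ℂ) :
    (jacobiPoly n a b).eval w = (ascPochhammer ℂ n).eval (a + 1) / n.factorial
      * ∑ s ∈ Finset.range (n + 1), (ascPochhammer ℂ s).eval (-(n : ℂ))
        * (ascPochhammer ℂ s).eval (n + a + b + 1)
        / ((ascPochhammer ℂ s).eval (a + 1) * s.factorial) * (-w) ^ s := by
  rw [jacobiPoly, eval_finsetSum, Finset.mul_sum]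
  refine Finset.sum_congr rfl fun k hk => ?_
  have hk' : k ≤ n := by simpa [Nat.lt_succ_iff] using hk
  have h1 := congrArg (eval (a + 1)) (ascPochhammer_mul ℂ k (n - k))
  rw [Nat.add_sub_cancel' hk', eval_mul, eval_comp] at h1
  simp only [eval_add, eval_X, eval_natCast] at h1
  have hf : (k.factorial : ℂ) ≠ 0 := by exact_mod_cast k.factorial_ne_zero
  have hn : (n.factorial : ℂ) ≠ 0 := by exact_mod_cast n.factorial_ne_zero
  have h2 := ha k hk'
  rw [eval_monomial, ← choose_mul_neg_one_pow hk', ← h1, show a + (k : ℂ) + 1 = a + 1 + k by ring,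
    neg_pow w]
  have h3 : ((-1 : ℂ) ^ k) * (-1) ^ k = 1 := by rw [← mul_pow]; norm_num
  field_simp
  linear_combination -((n.choose k : ℂ) * eval (a + 1 + k) (ascPochhammer ℂ (n - k))
    * eval (n + a + b + 1) (ascPochhammer ℂ k) * w ^ k) * h3

theorem conj_eval_ascPochhammer (k : ℕ) (x : ℂ) :
    starRingEnd ℂ ((ascPochhammer ℂ k).eval x) = (ascPochhammer ℂ k).eval (starRingEnd ℂ x) := by
  induction k with
  | zero => simp
  | succ k ih => simp [ascPochhammer_eval_succ_right, ih]

end Jacobi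

namespace PoschlTeller

open CotWell

variable {p : PoschlTeller}

/-- The hypergeometric coefficients of the Jacobi polynomial of `φ_n`. -/
def hypCoeff (p : PoschlTeller) (n s : ℕ) : ℂ :=
  (ascPochhammer ℂ s).eval (-(n : ℂ)) * (ascPochhammer ℂ s).eval (-2 * p.nu - n - 1 : ℂ)
    / ((ascPochhammer ℂ s).eval (-p.nu - n + Complex.I * p.bn n : ℂ) * s.factorial)

theorem conj_hypCoeff (n k : ℕ) : starRingEnd ℂ (p.hypCoeff n k)
    = (ascPochhammer ℂ k).eval (-(n : ℂ)) * (ascPochhammer ℂ k).eval (-2 * p.nu - n - 1 : ℂ)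
    / ((ascPochhammer ℂ k).eval (-p.nu - n - Complex.I * p.bn n : ℂ) * k.factorial) := by
  simp [hypCoeff, conj_eval_ascPochhammer, sub_eq_add_neg, Complex.conj_ofNat]

theorem eval_ascPochhammer_ne_zero (hnu : 0 ≤ p.nu) {n k : ℕ} (hk : k ≤ n) :
    (ascPochhammer ℂ k).eval (-p.nu - n + Complex.I * p.bn n : ℂ) ≠ 0 := by
  rw [Ne, ascPochhammer_eval_eq_zero_iff]
  rintro ⟨j, hj, h⟩
  have h4 := congrArg Complex.re h
  simp at h4
  have : (j : ℝ) + 1 ≤ n := by exact_mod_cast (by omega : j + 1 ≤ n)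
  linarith

theorem bigT_eq (n : ℕ) : p.bigT n
    = ‖(ascPochhammer ℂ n).eval (-p.nu - n + Complex.I * p.bn n : ℂ) / n.factorial‖⁻¹ := by
  rw [bigT, norm_div, Complex.norm_natCast, inv_div, div_eq_mul_inv]
  congr 5
  ring

theorem bigT_pos (hnu : 0 ≤ p.nu) (n : ℕ) : 0 < p.bigT n := by
  have := norm_pos_iff.mpr (eval_ascPochhammer_ne_zero hnu (le_refl n))
  rw [bigT_eq, norm_div, Complex.norm_natCast]
  have : (0 : ℝ) < n.factorial := by exact_mod_cast n.factorial_pos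
  positivity

/-- The exponents of the terms of `|φ_n|²`. -/
def expSum (p : PoschlTeller) (n k s : ℕ) : ℝ := 2 * (p.nu + n + 1) - k - s

/-- The frequencies of the terms of `|φ_n|²`. -/
def freq (p : PoschlTeller) (n k s : ℕ) : ℂ :=
  (p.nu + n + 1 - k + Complex.I * p.bn n) - (p.nu + n + 1 - s - Complex.I * p.bn n)

/-- In this form powers of -w become exponentials over powers of sin. -/
theorem neg_jacobiVar (hL : 0 < p.L) {x : ℝ} (hx : x ∈ p.dom) :
    -p.jacobiVar x = -(Complex.I / 2) * (Complex.exp (Complex.I * (Real.pi * x / p.L : ℝ))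
      / (Real.sin (Real.pi * x / p.L) : ℝ)) := by
  have hs : (Real.sin (Real.pi * x / p.L) : ℂ) ≠ 0 := by exact_mod_cast (sin_pos hL hx).ne'
  rw [jacobiVar, Real.cot_eq_cos_div_sin, mul_comm Complex.I ((Real.pi * x / p.L : ℝ) : ℂ),
    Complex.exp_mul_I, ← Complex.ofReal_cos, ← Complex.ofReal_sin]
  generalize Real.sin (Real.pi * x / p.L) = s at hs ⊢
  push_cast
  field_simp
  linear_combination (s : ℂ) * Complex.I_sq

theorem psi_eq_sum (hL : 0 < p.L) (hnu : 0 ≤ p.nu) (n : ℕ) {x : ℝ} (hx : x ∈ p.dom) :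
    p.psi n x = (ascPochhammer ℂ n).eval (-p.nu - n + Complex.I * p.bn n : ℂ) / n.factorial
      * ((groundState p.L p.beta (p.nu + n) x : ℂ) * ∑ s ∈ Finset.range (n + 1), p.hypCoeff n s
        * (-(Complex.I / 2) * (Complex.exp (Complex.I * (Real.pi * x / p.L : ℝ))
          / (Real.sin (Real.pi * x / p.L) : ℝ))) ^ s) := by
  have e1 : p.an n + 1 = -p.nu - n + Complex.I * p.bn n := by rw [an]; ring
  have e2 : n + p.an n + starRingEnd ℂ (p.an n) + 1 = -2 * p.nu - n - 1 := by
    rw [conj_an, an]; ring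
  rw [psi, jacobiPoly_eval_eq_hypergeometric (fun k hk => by
    rw [e1]; exact eval_ascPochhammer_ne_zero hnu hk), e1, e2, neg_jacobiVar hL hx]
  simp only [hypCoeff]
  ring

/-- The hypergeometric sum is multiplied by its conjugate. The real exponential is absorbed as the
imaginary part of the frequency s - k + 2i b_n. -/
theorem norm_psi_sq_eq_sum (hL : 0 < p.L) (hnu : 0 ≤ p.nu) (n : ℕ) {x : ℝ} (hx : x ∈ p.dom) :
    ((‖p.psi n x‖ ^ 2 : ℝ) : ℂ) = ((p.bigT n ^ 2)⁻¹ : ℝ)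
      * ∑ k ∈ Finset.range (n + 1), ∑ s ∈ Finset.range (n + 1),
        starRingEnd ℂ (p.hypCoeff n k) * p.hypCoeff n s
          * ((Complex.I / 2) ^ k * (-(Complex.I / 2)) ^ s)
          * (((Real.sin (Real.pi * x / p.L) ^ p.expSum n k s : ℝ) : ℂ)
            * Complex.exp (Complex.I * p.freq n k s * (Real.pi * x / p.L : ℝ))) := by
  have hs := sin_pos hL hx
  have hsc : (Real.sin (Real.pi * x / p.L) : ℂ) ≠ 0 := by exact_mod_cast hs.ne'
  rw [psi_eq_sum hL hnu n hx, norm_mul, mul_pow, bigT_eq, inv_pow, inv_inv, Complex.ofReal_mul]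
  congr 1
  rw [Complex.ofReal_pow, ← Complex.conj_mul']
  simp only [map_mul, map_sum, Complex.conj_ofReal, map_pow, map_neg, map_div₀, Complex.conj_I,
    Complex.conj_ofNat, ← Complex.exp_conj]
  rw [mul_mul_mul_comm, Finset.sum_mul_sum, Finset.mul_sum]
  refine Finset.sum_congr rfl fun k hk => ?_
  rw [Finset.mul_sum]
  refine Finset.sum_congr rfl fun s hs' => ?_
  have h1 : Real.sin (Real.pi * x / p.L) ^ (p.nu + n + 1) * Real.sin (Real.pi * x / p.L) ^ (p.nu + n + 1)
      = Real.sin (Real.pi * x / p.L) ^ p.expSum n k s * Real.sin (Real.pi * x / p.L) ^ k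
        * Real.sin (Real.pi * x / p.L) ^ s := by
    rw [← Real.rpow_natCast, ← Real.rpow_natCast, ← Real.rpow_add hs, ← Real.rpow_add hs,
      ← Real.rpow_add hs, expSum]
    congr 1; ring
  have h1c := congrArg (fun r : ℝ => (r : ℂ)) h1
  have h2 : ((Real.exp (-(p.beta * Real.pi * x / (p.L * (p.nu + n + 1)))) : ℝ) : ℂ)
      = Complex.exp (-(p.bn n * (Real.pi * x / p.L : ℝ))) := by
    rw [bn]
    push_cast
    congr 2
    rw [div_mul_div_comm, add_comm (p.nu : ℂ) n]
    ring
  have h3 : Complex.exp (Complex.I * p.freq n k s * (Real.pi * x / p.L : ℝ))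
      = Complex.exp (-(p.bn n * (Real.pi * x / p.L : ℝ)))
        * Complex.exp (-(p.bn n * (Real.pi * x / p.L : ℝ)))
        * Complex.exp (-Complex.I * (Real.pi * x / p.L : ℝ)) ^ k
        * Complex.exp (Complex.I * (Real.pi * x / p.L : ℝ)) ^ s := by
    rw [← Complex.exp_nat_mul, ← Complex.exp_nat_mul, ← Complex.exp_add, ← Complex.exp_add,
      ← Complex.exp_add, freq]
    congr 1
    linear_combination 2 * (p.bn n) * (Real.pi * x / p.L : ℝ) * Complex.I_sq
  rw [h3, groundState, Complex.ofReal_mul, h2]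
  simp only [Complex.ofReal_mul, Complex.ofReal_pow] at h1c
  generalize Complex.exp (-(p.bn n * (Real.pi * x / p.L : ℝ))) = E1
  generalize Complex.exp (-Complex.I * (Real.pi * x / p.L : ℝ)) = E2
  generalize Complex.exp (Complex.I * (Real.pi * x / p.L : ℝ)) = E3
  generalize ((Real.sin (Real.pi * x / p.L) ^ (p.nu + n + 1) : ℝ) : ℂ) = r at h1c ⊢
  generalize ((Real.sin (Real.pi * x / p.L) ^ p.expSum n k s : ℝ) : ℂ) = r2 at h1c ⊢
  generalize ((Real.sin (Real.pi * x / p.L) : ℝ) : ℂ) = S at hsc h1c ⊢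
  generalize starRingEnd ℂ (p.hypCoeff n k) = d
  generalize p.hypCoeff n s = d'
  simp only [mul_pow, div_pow, neg_div, neg_neg]
  field_simp
  linear_combination (E1 ^ 2 * d * E2 ^ k * d' * E3 ^ s) * h1c

/-- Here α = ν+n+1-k+i b_n and β = ν+n+1-s-i b_n. The factor e^{i(α-β)π/2} = i^s (-i)^k e^{-b_n π}
cancels the phases in front, and the powers of 2 combine to one independent of k and s. So only
Gamma functions depend on k and s. -/
theorem sinExpIntegral_term (hnu : 0 ≤ p.nu) {n k s : ℕ} (hk : k ≤ n) (hs : s ≤ n) :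
    ((Complex.I / 2) ^ k * (-(Complex.I / 2)) ^ s)
      * sinExpIntegral (p.expSum n k s) (p.freq n k s)
    = (Real.pi * Real.exp (-(p.bn n * Real.pi)) / 2 ^ (2 * (p.nu + n + 1)) : ℝ)
      * (Complex.Gamma (2 * n + 2 * p.nu - s - k + 3)
        / (Complex.Gamma (n + p.nu + 2 - k + Complex.I * p.bn n)
          * Complex.Gamma (n + p.nu + 2 - s - Complex.I * p.bn n))) := by
  have hk' : (k : ℝ) ≤ n := by exact_mod_cast hk
  have hs' : (s : ℝ) ≤ n := by exact_mod_cast hs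
  rw [freq, sinExpIntegral_eq (p := p.expSum n k s) (by simp; linarith) (by simp; linarith)
    (by rw [expSum]; push_cast; ring)]
  have e1 : ((p.expSum n k s : ℝ) : ℂ) + 1 = 2 * n + 2 * p.nu - s - k + 3 := by
    rw [expSum]; push_cast; ring
  have e2 : (p.nu + n + 1 - k + Complex.I * p.bn n : ℂ) + 1
      = n + p.nu + 2 - k + Complex.I * p.bn n := by ring
  have e3 : (p.nu + n + 1 - s - Complex.I * p.bn n : ℂ) + 1
      = n + p.nu + 2 - s - Complex.I * p.bn n := by ring
  rw [e1, e2, e3]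
  have h1 : Complex.exp (Complex.I * ((p.nu + n + 1 - k + Complex.I * p.bn n)
      - (p.nu + n + 1 - s - Complex.I * p.bn n)) * (Real.pi / 2 : ℝ))
      = Complex.I ^ s * (-Complex.I) ^ k * (Real.exp (-(p.bn n * Real.pi)) : ℝ) := by
    have hI : Complex.exp (Real.pi / 2 * Complex.I) = Complex.I := Complex.exp_pi_div_two_mul_I
    have hI' : Complex.exp (-(Real.pi / 2 * Complex.I)) = -Complex.I := by
      rw [Complex.exp_neg, hI, Complex.inv_I]
    rw [← hI', ← congrArg (· ^ s) hI, Complex.ofReal_exp]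
    rw [← Complex.exp_nat_mul, ← Complex.exp_nat_mul, ← Complex.exp_add, ← Complex.exp_add]
    congr 1
    push_cast
    linear_combination (p.bn n * Real.pi : ℂ) * Complex.I_sq
  have h2 : (2 : ℝ) ^ (2 * (p.nu + n + 1)) = 2 ^ p.expSum n k s * 2 ^ k * 2 ^ s := by
    rw [← Real.rpow_natCast, ← Real.rpow_natCast, ← Real.rpow_add two_pos, ← Real.rpow_add two_pos,
      expSum]
    congr 1; ring
  have h3 : Complex.I ^ k * (-Complex.I) ^ k = 1 := by
    rw [← mul_pow]; simp
  have h4 : (-Complex.I) ^ s * Complex.I ^ s = 1 := by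
    rw [← mul_pow]; simp
  have hr : ((2 ^ p.expSum n k s : ℝ) : ℂ) ≠ 0 := by
    exact_mod_cast (Real.rpow_pos_of_pos two_pos _).ne'
  rw [h1, h2]
  generalize Complex.Gamma (n + p.nu + 2 - k + Complex.I * p.bn n) = g1
  generalize Complex.Gamma (n + p.nu + 2 - s - Complex.I * p.bn n) = g2
  simp only [Complex.ofReal_mul, Complex.ofReal_div, Complex.ofReal_pow, Complex.ofReal_ofNat,
    ← neg_div, div_pow]
  rw [show ∀ A B C D E F G H K : ℂ, (A / B * (C / D)) * (E * (F * G * H) * K / (((2 ^ p.expSum n k s : ℝ) : ℂ) * (g1 * g2)))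
    = (A * G) * (C * F) * (E * H / (((2 ^ p.expSum n k s : ℝ) : ℂ) * B * D) * (K / (g1 * g2))) from
    fun A B C D E F G H K => by
      rw [div_mul_div_comm, div_mul_div_comm, div_mul_div_comm, mul_div_assoc']; ring_nf, h3, h4]
  ring

theorem bigO_eq_sum (n : ℕ) : p.bigO n = ∑ k ∈ Finset.range (n + 1), ∑ s ∈ Finset.range (n + 1),
    starRingEnd ℂ (p.hypCoeff n k) * p.hypCoeff n s
      * (Complex.Gamma (2 * n + 2 * p.nu - s - k + 3)
        / (Complex.Gamma (n + p.nu + 2 - k + Complex.I * p.bn n)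
          * Complex.Gamma (n + p.nu + 2 - s - Complex.I * p.bn n))) := by
  rw [bigO]
  refine Finset.sum_congr rfl fun k _ => Finset.sum_congr rfl fun s _ => ?_
  rw [conj_hypCoeff, hypCoeff, div_mul_div_comm, div_mul_div_comm, div_mul_div_comm]
  congr 1 <;> ring

/-- The factor that relates `𝒪(n)` to the norm of `psi`. -/
def normFactor (p : PoschlTeller) (n : ℕ) : ℝ :=
  p.L * (p.bigT n ^ 2)⁻¹ * Real.exp (-(p.bn n * Real.pi)) / 2 ^ (2 * (p.nu + n + 1))

/-- Termwise integration with θ = πx/L: the common factor comes out and the remaining double sum is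
𝒪(n). That 𝒪(n) is real and positive is a consequence. -/
theorem normSq_psi (hL : 0 < p.L) (hnu : 0 ≤ p.nu) (n : ℕ) :
    (CotWell.normSq p.L (p.psi n) : ℂ) = p.normFactor n * p.bigO n := by
  have hpi := Real.pi_pos
  rw [CotWell.normSq, ← integral_complex_ofReal, setIntegral_congr_fun measurableSet_Ioo
    (fun x hx => norm_psi_sq_eq_sum hL hnu n hx), ← integral_Ioc_eq_integral_Ioo,
    ← intervalIntegral.integral_of_le hL.le, intervalIntegral.integral_const_mul]
  have hexp : ∀ k ∈ Finset.range (n + 1), ∀ s ∈ Finset.range (n + 1), 0 ≤ p.expSum n k s := by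
    intro k hk s hs
    have hk' : (k : ℝ) ≤ n := by exact_mod_cast Nat.lt_succ_iff.mp (Finset.mem_range.mp hk)
    have hs' : (s : ℝ) ≤ n := by exact_mod_cast Nat.lt_succ_iff.mp (Finset.mem_range.mp hs)
    rw [expSum]; linarith
  have hcont : ∀ k ∈ Finset.range (n + 1), ∀ s ∈ Finset.range (n + 1),
      Continuous fun x : ℝ => starRingEnd ℂ (p.hypCoeff n k) * p.hypCoeff n s
          * ((Complex.I / 2) ^ k * (-(Complex.I / 2)) ^ s)
          * (((Real.sin (Real.pi * x / p.L) ^ p.expSum n k s : ℝ) : ℂ)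
            * Complex.exp (Complex.I * p.freq n k s * (Real.pi * x / p.L : ℝ))) :=
    fun k hk s hs => continuous_const.mul ((continuous_sin_rpow_mul_cexp (hexp k hk s hs) _).comp
      (by fun_prop : Continuous fun x : ℝ => Real.pi * x / p.L))
  rw [intervalIntegral.integral_finsetSum fun k hk =>
    (continuous_finsetSum _ fun s hs => hcont k hk s hs).intervalIntegrable _ _]
  have hterm : ∀ k ∈ Finset.range (n + 1), ∀ s ∈ Finset.range (n + 1),
      ∫ x in (0 : ℝ)..p.L, starRingEnd ℂ (p.hypCoeff n k) * p.hypCoeff n s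
          * ((Complex.I / 2) ^ k * (-(Complex.I / 2)) ^ s)
          * (((Real.sin (Real.pi * x / p.L) ^ p.expSum n k s : ℝ) : ℂ)
            * Complex.exp (Complex.I * p.freq n k s * (Real.pi * x / p.L : ℝ)))
      = (p.L * Real.exp (-(p.bn n * Real.pi)) / 2 ^ (2 * (p.nu + n + 1)) : ℝ)
        * (starRingEnd ℂ (p.hypCoeff n k) * p.hypCoeff n s
      * (Complex.Gamma (2 * n + 2 * p.nu - s - k + 3)
        / (Complex.Gamma (n + p.nu + 2 - k + Complex.I * p.bn n)
          * Complex.Gamma (n + p.nu + 2 - s - Complex.I * p.bn n)))) := by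
    intro k hk s hs
    have h1 := intervalIntegral.integral_comp_mul_left (a := 0) (b := p.L)
      (fun t : ℝ => ((Real.sin t ^ p.expSum n k s : ℝ) : ℂ)
        * Complex.exp (Complex.I * p.freq n k s * t)) (c := Real.pi / p.L) (by positivity)
    rw [mul_zero, div_mul_cancel₀ _ hL.ne', ← sinExpIntegral] at h1
    have h2 := sinExpIntegral_term (p := p) hnu (Nat.lt_succ_iff.mp (Finset.mem_range.mp hk))
      (Nat.lt_succ_iff.mp (Finset.mem_range.mp hs))
    have h3 : ∀ x : ℝ, Real.pi * x / p.L = Real.pi / p.L * x := fun x => by ring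
    rw [intervalIntegral.integral_const_mul]
    simp only [h3]
    rw [h1, Complex.real_smul]
    have hpic : (Real.pi : ℂ) ≠ 0 := by exact_mod_cast hpi.ne'
    have e : (((Real.pi / p.L)⁻¹ : ℝ) : ℂ) = p.L / Real.pi := by push_cast; rw [inv_div]
    rw [e]
    calc _ = starRingEnd ℂ (p.hypCoeff n k) * p.hypCoeff n s * (p.L / Real.pi)
          * (((Complex.I / 2) ^ k * (-(Complex.I / 2)) ^ s)
            * sinExpIntegral (p.expSum n k s) (p.freq n k s)) := by ring
      _ = _ := by
        rw [h2]
        simp only [Complex.ofReal_mul, Complex.ofReal_div]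
        field_simp
  rw [bigO_eq_sum, normFactor, Finset.sum_congr rfl fun k hk => by
    rw [intervalIntegral.integral_finsetSum fun s hs => (hcont k hk s hs).intervalIntegrable _ _,
      Finset.sum_congr rfl (hterm k hk), ← Finset.mul_sum], ← Finset.mul_sum, ← mul_assoc]
  congr 1
  rw [← Complex.ofReal_mul]
  congr 1
  ring

theorem normFactor_pos (hL : 0 < p.L) (hnu : 0 ≤ p.nu) (n : ℕ) : 0 < p.normFactor n := by
  have h1 := bigT_pos hnu n
  have h2 := Real.rpow_pos_of_pos two_pos (2 * (p.nu + n + 1))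
  have h3 := Real.exp_pos (-(p.bn n * Real.pi))
  rw [normFactor]
  positivity

theorem bigO_eq_ofReal (hL : 0 < p.L) (hnu : 0 ≤ p.nu) (n : ℕ) :
    p.bigO n = (CotWell.normSq p.L (p.psi n) / p.normFactor n : ℝ) := by
  have h := normSq_psi hL hnu n
  have h1 : (p.normFactor n : ℂ) ≠ 0 := by exact_mod_cast (normFactor_pos hL hnu n).ne'
  push_cast
  rw [h, mul_div_cancel_left₀ _ h1]

theorem bigO_im (hL : 0 < p.L) (hnu : 0 ≤ p.nu) (n : ℕ) : (p.bigO n).im = 0 := by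
  rw [bigO_eq_ofReal hL hnu]
  exact Complex.ofReal_im _

theorem normSq_psi_pos (hL : 0 < p.L) (hnu : 0 ≤ p.nu) (hbeta : 0 ≤ p.beta) (n : ℕ) :
    0 < CotWell.normSq p.L (p.psi n) :=
  (isSol_psi hL hnu hbeta n).normSq_pos hL (exists_psi_ne_zero hL hnu n)

theorem bigO_re_pos (hL : 0 < p.L) (hnu : 0 ≤ p.nu) (hbeta : 0 ≤ p.beta) (n : ℕ) :
    0 < (p.bigO n).re := by
  rw [bigO_eq_ofReal hL hnu, Complex.ofReal_re]
  exact div_pos (normSq_psi_pos hL hnu hbeta n) (normFactor_pos hL hnu n)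

theorem Kn_sq (hL : 0 < p.L) (hnu : 0 ≤ p.nu) (hbeta : 0 ≤ p.beta) (n : ℕ) :
    p.Kn n ^ 2 = (CotWell.normSq p.L (p.psi n))⁻¹ := by
  have hO := bigO_re_pos hL hnu hbeta n
  have h1 : (p.bigO n).re = CotWell.normSq p.L (p.psi n) / p.normFactor n := by
    rw [bigO_eq_ofReal hL hnu, Complex.ofReal_re]
  have h2 : CotWell.normSq p.L (p.psi n) = (p.bigO n).re * p.normFactor n := by
    rw [h1, div_mul_cancel₀ _ (normFactor_pos hL hnu n).ne']
  have e1 : ((2 : ℝ) ^ ((n : ℝ) + p.nu + 1)) ^ 2 = 2 ^ (2 * (p.nu + n + 1)) := by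
    rw [← Real.rpow_natCast, ← Real.rpow_mul two_pos.le]
    congr 1; push_cast; ring
  have e2 : Real.exp (p.beta * Real.pi / (2 * (n + p.nu + 1))) ^ 2
      = (Real.exp (-(p.bn n * Real.pi)))⁻¹ := by
    rw [← Real.exp_nat_mul, ← Real.exp_neg, bn]
    congr 1
    have : (n : ℝ) + p.nu + 1 ≠ 0 := by positivity
    push_cast
    field_simp
  have hT := (bigT_pos hnu n).ne'
  rw [h2, Kn, mul_pow, mul_pow, mul_pow, mul_pow, e1, e2, inv_pow, inv_pow, Real.sq_sqrt hL.le,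
    Real.sq_sqrt hO.le, normFactor]
  have h3 := (Real.rpow_pos_of_pos two_pos (2 * (p.nu + n + 1))).ne'
  have h4 := (Real.exp_pos (-(p.bn n * Real.pi))).ne'
  generalize (2 : ℝ) ^ (2 * (p.nu + n + 1)) = A at *
  generalize Real.exp (-(p.bn n * Real.pi)) = B at *
  field_simp

theorem Kn_pos (hL : 0 < p.L) (hnu : 0 ≤ p.nu) (hbeta : 0 ≤ p.beta) (n : ℕ) : 0 < p.Kn n := by
  have h1 := bigT_pos hnu n
  have h2 := Real.rpow_pos_of_pos two_pos ((n : ℝ) + p.nu + 1)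
  have h3 := bigO_re_pos hL hnu hbeta n
  rw [Kn]
  positivity

theorem normSq_const_mul (L : ℝ) (c : ℂ) (f : ℝ → ℂ) :
    CotWell.normSq L (fun x => c * f x) = ‖c‖ ^ 2 * CotWell.normSq L f := by
  simp only [CotWell.normSq, norm_mul, mul_pow, integral_const_mul]

theorem normSq_phi0 (hL : 0 < p.L) (hnu : 0 ≤ p.nu) (hbeta : 0 ≤ p.beta) (n : ℕ) :
    CotWell.normSq p.L (p.phi0 n) = 1 := by
  rw [funext (p.phi0_eq n), normSq_const_mul, Complex.norm_real, Real.norm_eq_abs, sq_abs,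
    Kn_sq hL hnu hbeta, inv_mul_cancel₀ (normSq_psi_pos hL hnu hbeta n).ne']

end PoschlTeller

/-! ### The hierarchy as the shift ν ↦ ν + m -/

namespace PoschlTeller

open CotWell

/-- The parameters are in the physical range. -/
structure Admissible (p : PoschlTeller) : Prop where
  hbar_pos : 0 < p.hbar
  M_pos : 0 < p.M
  L_pos : 0 < p.L
  nu_nonneg : 0 ≤ p.nu
  beta_nonneg : 0 ≤ p.beta

/-- The same system with `ν` replaced by `ν + m`. -/
def shift (p : PoschlTeller) (m : ℕ) : PoschlTeller := { p with nu := p.nu + m }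

variable {p : PoschlTeller}

theorem Admissible.shift (hp : p.Admissible) (m : ℕ) : (p.shift m).Admissible :=
  ⟨hp.1, hp.2, hp.3, add_nonneg hp.4 m.cast_nonneg, hp.5⟩

theorem shift_zero (p : PoschlTeller) : p.shift 0 = p := by
  simp [PoschlTeller.shift]

theorem shift_shift_one (p : PoschlTeller) (m : ℕ) : (p.shift m).shift 1 = p.shift (m + 1) := by
  simp [PoschlTeller.shift, add_assoc]

theorem _root_.CotWell.IsSol.const_mul {L b l : ℝ} {e : ℂ} {f : ℝ → ℂ} (hf : IsSol L b l e f)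
    (hL : 0 < L) (c : ℂ) : IsSol L b l e (fun x => c * f x) :=
  (hf.sub_const_mul hf (1 - c)).congr hL fun x _ => by ring

theorem isSol_phi0 (hp : p.Admissible) (n : ℕ) :
    IsSol p.L p.beta p.nu (level p.L p.beta (p.nu + n)) (p.phi0 n) :=
  ((isSol_psi hp.3 hp.4 hp.5 n).const_mul hp.3 (p.Kn n)).congr hp.3 fun x _ => (p.phi0_eq n x).symm

theorem exists_phi0_ne_zero (hp : p.Admissible) (n : ℕ) : ∃ x ∈ Ioo 0 p.L, p.phi0 n x ≠ 0 := by
  obtain ⟨x, hx, hne⟩ := exists_psi_ne_zero hp.3 hp.4 n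
  refine ⟨x, hx, ?_⟩
  rw [phi0_eq]
  exact mul_ne_zero (by exact_mod_cast (Kn_pos hp.3 hp.4 hp.5 n).ne') hne

theorem psi_zero (p : PoschlTeller) : p.psi 0 = fun x => (groundState p.L p.beta p.nu x : ℂ) := by
  funext x
  simp [psi, jacobiPoly]

theorem phi0_zero_ne_zero (hp : p.Admissible) {x : ℝ} (hx : x ∈ p.dom) : p.phi0 0 x ≠ 0 := by
  simp only [phi0_eq, psi_zero]
  exact mul_ne_zero (by exact_mod_cast (Kn_pos hp.3 hp.4 hp.5 0).ne')
    (by exact_mod_cast (groundState_pos hp.3 hx).ne')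

theorem dom_mem_nhds {x : ℝ} (hx : x ∈ p.dom) : p.dom ∈ 𝓝 x := isOpen_Ioo.mem_nhds hx

/-- A logarithmic derivative is blind to the constant c, so phases picked up along the hierarchy do
not affect the superpotentials. -/
theorem superpotOf_eq (hp : p.Admissible) {g : ℝ → ℂ} {c : ℂ} (hc : c ≠ 0)
    (hg : ∀ x ∈ p.dom, g x = c * p.phi0 0 x) {x : ℝ} (hx : x ∈ p.dom) :
    p.superpotOf g x = ((-(p.hbar * logSlope p.L p.beta p.nu x) : ℝ) : ℂ) := by
  have hev : g =ᶠ[𝓝 x] fun x => c * (p.Kn 0 * (groundState p.L p.beta p.nu x : ℂ)) := by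
    filter_upwards [dom_mem_nhds hx] with y hy
    rw [hg y hy, phi0_eq, psi_zero]
  have hd := (((hasDerivAt_groundState (b := p.beta) (l := p.nu) hp.3 hx).ofReal_comp.const_mul
    (p.Kn 0 : ℂ)).const_mul c).congr_of_eventuallyEq hev
  have hK : (p.Kn 0 : ℂ) ≠ 0 := by exact_mod_cast (Kn_pos hp.3 hp.4 hp.5 0).ne'
  have hG : (groundState p.L p.beta p.nu x : ℂ) ≠ 0 := by
    exact_mod_cast (groundState_pos hp.3 hx).ne'
  rw [superpotOf, hd.deriv, hev.eq_of_nhds]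
  push_cast
  field_simp

theorem E0_eq_level (hp : p.Admissible) (n : ℕ) :
    p.E0 n = p.hbar ^ 2 / (2 * p.M) * level p.L p.beta (p.nu + n) := by
  have := hp.M_pos.ne'
  have := hp.L_pos.ne'
  have : (n : ℝ) + p.nu + 1 ≠ 0 := by have := hp.nu_nonneg; positivity
  rw [E0, eps0, level, add_comm p.nu]
  field_simp

theorem E0_lt (hp : p.Admissible) {k n : ℕ} (h : k < n) : p.E0 k < p.E0 n := by
  have h1 : level p.L p.beta (p.nu + k) < level p.L p.beta (p.nu + n) :=
    level_lt hp.3 (by have := hp.nu_nonneg; positivity) (by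
      have : (k : ℝ) < n := by exact_mod_cast h
      linarith)
  have := hp.M_pos
  have := hp.hbar_pos
  rw [E0_eq_level hp, E0_eq_level hp]
  exact mul_lt_mul_of_pos_left h1 (by positivity)

/-- Lowering `φ_{n+1}` gives a multiple of `φ_n` for the next value of `ν`. -/
theorem lower_phi0_succ (hp : p.Admissible) (n : ℕ) :
    ∃ d : ℂ, ‖d‖ ^ 2 = level p.L p.beta (p.nu + (n + 1 : ℕ)) - level p.L p.beta p.nu ∧ d ≠ 0 ∧
      ∀ x ∈ p.dom, lowerOp p.L p.beta p.nu (p.phi0 (n + 1)) x = d * (p.shift 1).phi0 n x := by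
  have h1 := isSol_phi0 hp (n + 1)
  have h2 := h1.lower hp.3 hp.4
  have h3 := isSol_phi0 (hp.shift 1) n
  have e1 : (p.shift 1).nu = p.nu + 1 := by simp [PoschlTeller.shift]
  have e2 : p.nu + ((n + 1 : ℕ) : ℝ) = p.nu + 1 + n := by push_cast; ring
  rw [e1] at h3
  rw [e2] at h2
  -- Both functions solve the problem for ν + 1 at the same level, and levels are simple. The norm
  -- identity then yields |d|.
  obtain ⟨d, hd⟩ := IsSol.exists_eq_const_mul hp.3 n (by linarith [hp.4]) h3 h2
    (exists_phi0_ne_zero (hp.shift 1) n)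
  have hnorm : ‖d‖ ^ 2 = level p.L p.beta (p.nu + (n + 1 : ℕ)) - level p.L p.beta p.nu := by
    have h4 := h1.normSq_lower hp.3 hp.4
    rw [normSq_phi0 hp.3 hp.4 hp.5] at h4
    have h5 : CotWell.normSq p.L (lowerOp p.L p.beta p.nu (p.phi0 (n + 1)))
        = ‖d‖ ^ 2 * CotWell.normSq p.L ((p.shift 1).phi0 n) := by
      rw [← normSq_const_mul]
      refine setIntegral_congr_fun measurableSet_Ioo fun x hx => ?_
      simp only
      rw [hd x hx]
    have h6 : CotWell.normSq p.L ((p.shift 1).phi0 n) = 1 :=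
      normSq_phi0 (hp.shift 1).3 (hp.shift 1).4 (hp.shift 1).5 n
    rw [h5, h6] at h4
    simp only [mul_one, Complex.ofReal_one] at h4
    exact_mod_cast h4
  refine ⟨d, hnorm, ?_, hd⟩
  rintro rfl
  have : level p.L p.beta p.nu < level p.L p.beta (p.nu + (n + 1 : ℕ)) :=
    level_lt hp.3 (by linarith [hp.4]) (by push_cast; linarith [n.cast_nonneg (α := ℝ)])
  rw [norm_zero] at hnorm
  norm_num at hnorm this
  linarith

theorem opA_eq_of_eqOn {W f : ℝ → ℂ} (hW : ∀ x ∈ p.dom, W x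
      = ((-(p.hbar * logSlope p.L p.beta p.nu x) : ℝ) : ℂ)) {x : ℝ} (hx : x ∈ p.dom) :
    p.opA W f x = p.hbar * lowerOp p.L p.beta p.nu f x := by
  rw [opA, hW x hx, lowerOp]
  push_cast
  ring

theorem opA_const_mul {W f g : ℝ → ℂ} {c : ℂ} (h : ∀ x ∈ p.dom, f x = c * g x) {x : ℝ}
    (hx : x ∈ p.dom) : p.opA W f x = c * p.opA W g x := by
  have hev : f =ᶠ[𝓝 x] fun x => c * g x := by
    filter_upwards [dom_mem_nhds hx] with y hy using h y hy
  rw [opA, opA, hev.deriv_eq, h x hx, deriv_const_mul_field]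
  ring

theorem normalize_eq_of_eqOn {f g : ℝ → ℂ} {c : ℂ} (h : ∀ x ∈ p.dom, f x = c * g x)
    (hg : CotWell.normSq p.L g = 1) {x : ℝ} (hx : x ∈ p.dom) :
    p.normalize f x = c / ‖c‖ * g x := by
  have h1 : ∫ y, ‖f y‖ ^ 2 ∂p.vol = ‖c‖ ^ 2 := by
    rw [← mul_one (‖c‖ ^ 2), ← hg, ← normSq_const_mul]
    refine setIntegral_congr_fun measurableSet_Ioo fun y hy => ?_
    simp only
    rw [h y hy]
  rw [normalize, h1, Real.sqrt_sq (norm_nonneg c), h x hx]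
  ring

/-- The `m`-th member of the hierarchy is the original system with `ν` replaced by `ν + m`. -/
theorem phi_eq (hp : p.Admissible) (m : ℕ) : ∀ n : ℕ, ∃ c : ℂ, ‖c‖ = 1 ∧
    ∀ x ∈ p.dom, p.phi m n x = c * (p.shift m).phi0 n x := by
  induction m with
  | zero => exact fun n => ⟨1, norm_one, fun x _ => by rw [one_mul, shift_zero]; rfl⟩
  | succ m ih =>
    intro n
    obtain ⟨c0, hc0, h0⟩ := ih 0
    obtain ⟨c, hc, h⟩ := ih (n + 1)
    obtain ⟨d, -, hd0, hd⟩ := lower_phi0_succ (hp.shift m) n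
    rw [shift_shift_one] at hd
    have hc0' : c0 ≠ 0 := by rintro rfl; simp at hc0
    have hc' : c ≠ 0 := by rintro rfl; simp at hc
    have hA : ∀ x ∈ p.dom, p.opA (p.superpotOf (p.phi m 0)) (p.phi m (n + 1)) x
        = (c * (p.hbar * d)) * (p.shift (m + 1)).phi0 n x := by
      intro x hx
      rw [opA_const_mul h hx]
      have h1 := opA_eq_of_eqOn (p := p.shift m) (f := (p.shift m).phi0 (n + 1))
        (fun y hy => superpotOf_eq (hp.shift m) hc0' h0 hy) hx
      have h2 := hd x hx
      -- `shift` alters only ν, so operators built from ħ alone agree definitionally for both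
      -- systems.
      change c * (p.shift m).opA ((p.shift m).superpotOf (p.phi m 0)) _ x = _
      rw [h1, h2]
      change c * (p.hbar * _) = _
      ring
    have hp' := hp.shift (m + 1)
    refine ⟨_, ?_, fun x hx =>
      normalize_eq_of_eqOn hA (normSq_phi0 hp'.3 hp'.4 hp'.5 n) hx⟩
    have hne : c * (p.hbar * d) ≠ 0 :=
      mul_ne_zero hc' (mul_ne_zero (by exact_mod_cast hp.hbar_pos.ne') hd0)
    rw [norm_div, Complex.norm_real, norm_norm, div_self (norm_ne_zero_iff.mpr hne)]

theorem W_eq (hp : p.Admissible) (m : ℕ) {x : ℝ} (hx : x ∈ p.dom) :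
    p.W m x = ((-(p.hbar * logSlope p.L p.beta (p.nu + m) x) : ℝ) : ℂ) := by
  obtain ⟨c0, hc0, h0⟩ := phi_eq hp m 0
  have hc0' : c0 ≠ 0 := by rintro rfl; simp at hc0
  exact superpotOf_eq (hp.shift m) hc0' h0 hx

theorem A_eq (hp : p.Admissible) (m : ℕ) (f : ℝ → ℂ) {x : ℝ} (hx : x ∈ p.dom) :
    p.A m f x = p.hbar * lowerOp p.L p.beta (p.nu + m) f x :=
  opA_eq_of_eqOn (p := p.shift m) (fun _ hy => W_eq hp m hy) hx

theorem phi_ne_zero (hp : p.Admissible) (m : ℕ) {x : ℝ} (hx : x ∈ p.dom) : p.phi m 0 x ≠ 0 := by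
  obtain ⟨c0, hc0, h0⟩ := phi_eq hp m 0
  rw [h0 x hx]
  exact mul_ne_zero (by rintro rfl; simp at hc0) (phi0_zero_ne_zero (hp.shift m) hx)

theorem E0_shift (p : PoschlTeller) (m n : ℕ) : (p.shift m).E0 n = p.E0 (n + m) := by
  simp only [E0, eps0, PoschlTeller.shift]
  push_cast
  rw [show (n : ℝ) + (p.nu + m) + 1 = n + m + p.nu + 1 by ring]

theorem energy_eq (p : PoschlTeller) (m : ℕ) : ∀ n, p.energy m n = p.E0 (n + m) := by
  induction m with
  | zero => exact fun n => rfl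
  | succ m ih =>
    intro n
    rw [energy, ih]
    congr 1; ring

theorem normSq_A_phi (hp : p.Admissible) (m n : ℕ) :
    CotWell.normSq p.L (p.A m (p.phi m (n + 1))) = 2 * p.M * (p.E0 (n + m + 1) - p.E0 m) := by
  obtain ⟨c, hc, h⟩ := phi_eq hp m (n + 1)
  obtain ⟨d, hdn, hd0, hd⟩ := lower_phi0_succ (hp.shift m) n
  rw [shift_shift_one] at hd
  have hA : ∀ x ∈ p.dom, p.A m (p.phi m (n + 1)) x
      = (c * (p.hbar * d)) * (p.shift (m + 1)).phi0 n x := by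
    intro x hx
    have h2 := hd x hx
    have h3 : p.A m ((p.shift m).phi0 (n + 1)) x
        = p.hbar * lowerOp p.L p.beta (p.nu + m) ((p.shift m).phi0 (n + 1)) x := A_eq hp m _ hx
    have h4 : lowerOp p.L p.beta (p.nu + m) ((p.shift m).phi0 (n + 1)) x
        = d * (p.shift (m + 1)).phi0 n x := h2
    rw [A, opA_const_mul h hx, ← A, h3, h4]
    ring
  have hp' := hp.shift (m + 1)
  have h5 : CotWell.normSq p.L ((p.shift (m + 1)).phi0 n) = 1 := normSq_phi0 hp'.3 hp'.4 hp'.5 n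
  have h6 : CotWell.normSq p.L (p.A m (p.phi m (n + 1))) = ‖c * (p.hbar * d)‖ ^ 2 := by
    rw [← mul_one (‖_‖ ^ 2), ← h5, ← normSq_const_mul]
    refine setIntegral_congr_fun measurableSet_Ioo fun y hy => ?_
    simp only
    rw [hA y hy]
  have e1 := E0_eq_level (hp.shift m) (n + 1)
  have e2 := E0_eq_level (hp.shift m) 0
  rw [E0_shift] at e1 e2
  rw [zero_add] at e2
  rw [h6, norm_mul, norm_mul, hc, one_mul, mul_pow, hdn, Complex.norm_real, Real.norm_eq_abs, sq_abs,
    show n + m + 1 = n + 1 + m by ring, e1, e2, Nat.cast_zero, add_zero]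
  have := hp.M_pos.ne'
  change p.hbar ^ 2 * _ = 2 * p.M * (p.hbar ^ 2 / (2 * p.M) * _ - p.hbar ^ 2 / (2 * p.M) * _)
  field_simp

theorem phi_succ_eq (hp : p.Admissible) (m n : ℕ) (x : ℝ) :
    p.phi (m + 1) n x = p.A m (p.phi m (n + 1)) x
      / (Real.sqrt (2 * p.M * (p.E0 (n + m + 1) - p.E0 m)) : ℝ) := by
  rw [← normSq_A_phi hp]
  rfl

/-- The norm of A_m φ_{n+1}^{(m)} is known from `normSq_A_phi`; the constants of earlier steps pass
through the linear operator A_m, and the square roots multiply. -/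
theorem phi_succ_eq_B (hp : p.Admissible) (m : ℕ) : ∀ n : ℕ, ∀ x ∈ p.dom,
    p.phi (m + 1) n x = p.B m (p.phi0 (n + m + 1)) x
      / (Real.sqrt ((2 * p.M) ^ (m + 1)
          * ∏ k ∈ Finset.range (m + 1), (p.E0 (n + m + 1) - p.E0 k)) : ℝ) := by
  induction m with
  | zero =>
    intro n x _
    rw [phi_succ_eq hp]
    simp [B, phi]
  | succ m ih =>
    intro n x hx
    rw [phi_succ_eq hp, A, opA_const_mul (c := ((Real.sqrt ((2 * p.M) ^ (m + 1)
          * ∏ k ∈ Finset.range (m + 1), (p.E0 (n + 1 + m + 1) - p.E0 k)) : ℝ) : ℂ)⁻¹)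
      (fun y hy => by rw [ih (n + 1) y hy, div_eq_inv_mul]) hx, ← A, ← B,
      show n + 1 + m + 1 = n + (m + 1) + 1 by ring]
    rw [Finset.prod_range_succ _ (m + 1)]
    have h1 : 0 ≤ (2 * p.M) ^ (m + 1)
        * ∏ k ∈ Finset.range (m + 1), (p.E0 (n + (m + 1) + 1) - p.E0 k) := by
      have := hp.M_pos
      refine mul_nonneg (by positivity) (Finset.prod_nonneg fun k hk => ?_)
      have := Finset.mem_range.mp hk
      exact (sub_pos.mpr (E0_lt hp (by omega))).le
    have h2 : (2 * p.M) ^ (m + 1 + 1) * ((∏ k ∈ Finset.range (m + 1),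
        (p.E0 (n + (m + 1) + 1) - p.E0 k)) * (p.E0 (n + (m + 1) + 1) - p.E0 (m + 1)))
        = ((2 * p.M) ^ (m + 1) * ∏ k ∈ Finset.range (m + 1), (p.E0 (n + (m + 1) + 1) - p.E0 k))
          * (2 * p.M * (p.E0 (n + (m + 1) + 1) - p.E0 (m + 1))) := by ring
    rw [h2, Real.sqrt_mul h1, Complex.ofReal_mul, ← div_eq_inv_mul, div_div]

end PoschlTeller

/-! ### Potentials, factorizations, domains and the full spectrum -/

namespace PoschlTeller

open CotWell

variable {p : PoschlTeller}

theorem V0_eq_pot (hp : p.Admissible) (x : ℝ) :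
    p.V0 x = p.hbar ^ 2 / (2 * p.M) * pot p.L p.beta p.nu x := by
  have := hp.M_pos.ne'
  have := hp.L_pos.ne'
  rw [V0, eps0, pot]
  field_simp

theorem hasDerivAt_W (hp : p.Admissible) (m : ℕ) {x : ℝ} (hx : x ∈ p.dom) :
    HasDerivAt (p.W m) ((p.hbar * ((Real.pi / p.L) ^ 2 * (p.nu + m + 1)
      / Real.sin (Real.pi * x / p.L) ^ 2) : ℝ) : ℂ) x := by
  have hev : p.W m =ᶠ[𝓝 x] fun x => ((-(p.hbar * logSlope p.L p.beta (p.nu + m) x) : ℝ) : ℂ) := by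
    filter_upwards [dom_mem_nhds hx] with y hy using W_eq hp m hy
  have h := ((hasDerivAt_logSlope (b := p.beta) (l := p.nu + m) hp.3 hx).const_mul p.hbar).fun_neg
  convert! h.ofReal_comp.congr_of_eventuallyEq hev using 1
  push_cast
  ring

theorem energy_zero_eq (hp : p.Admissible) (m : ℕ) :
    p.energy m 0 = p.hbar ^ 2 / (2 * p.M) * level p.L p.beta (p.nu + m) := by
  rw [energy_eq, zero_add, E0_eq_level hp]

/-- Shape invariance: by the second Riccati equation, W_m² + ħW_m' yields the potential with
parameter ν + m + 1. -/
theorem V_eq_pot (hp : p.Admissible) (m : ℕ) {x : ℝ} (hx : x ∈ p.dom) :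
    p.V m x = ((p.hbar ^ 2 / (2 * p.M) * pot p.L p.beta (p.nu + m) x : ℝ) : ℂ) := by
  rcases m with _ | m
  · rw [V, V0_eq_pot hp, Nat.cast_zero, add_zero]
  · have h1 := congrArg (fun r : ℝ => (r : ℂ)) (logSlope_sq_sub (b := p.beta) (l := p.nu + m) hp.3
      (by have := hp.nu_nonneg; positivity) hx)
    rw [V, (hasDerivAt_W hp m hx).deriv, W_eq hp m hx, energy_zero_eq hp,
      show p.nu + ((m + 1 : ℕ) : ℝ) = p.nu + m + 1 by push_cast; ring]
    push_cast at h1 ⊢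
    linear_combination (p.hbar : ℂ) ^ 2 / (2 * p.M) * h1

theorem A_Adag_eq (hp : p.Admissible) (m : ℕ) {f : ℝ → ℂ} (hf : DifferentiableOn ℝ f p.dom)
    {x : ℝ} (hx : x ∈ p.dom) (hf' : DifferentiableAt ℝ (deriv f) x) :
    p.A m (p.Adag m f) x = -(p.hbar : ℂ) ^ 2 * deriv (deriv f) x
      + (p.W m x ^ 2 + p.hbar * deriv (p.W m) x) * f x := by
  have hd := (hf.differentiableAt (dom_mem_nhds hx)).hasDerivAt
  have hW := (hasDerivAt_W hp m hx).differentiableAt.hasDerivAt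
  have h1 : HasDerivAt (p.Adag m f) (-(p.hbar * deriv (deriv f) x)
      + (deriv (p.W m) x * f x + p.W m x * deriv f x)) x :=
    (hf'.hasDerivAt.const_mul (p.hbar : ℂ)).fun_neg.add (hW.mul hd)
  rw [A, opA, h1.deriv, Adag, opAdag]
  ring

theorem Adag_A_eq (hp : p.Admissible) (m : ℕ) {f : ℝ → ℂ} (hf : DifferentiableOn ℝ f p.dom)
    {x : ℝ} (hx : x ∈ p.dom) (hf' : DifferentiableAt ℝ (deriv f) x) :
    p.Adag m (p.A m f) x = -(p.hbar : ℂ) ^ 2 * deriv (deriv f) x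
      + (p.W m x ^ 2 - p.hbar * deriv (p.W m) x) * f x := by
  have hd := (hf.differentiableAt (dom_mem_nhds hx)).hasDerivAt
  have hW := (hasDerivAt_W hp m hx).differentiableAt.hasDerivAt
  have h1 : HasDerivAt (p.A m f) (p.hbar * deriv (deriv f) x
      + (deriv (p.W m) x * f x + p.W m x * deriv f x)) x :=
    (hf'.hasDerivAt.const_mul (p.hbar : ℂ)).add (hW.mul hd)
  rw [Adag, opAdag, h1.deriv, A, opA]
  ring

theorem H_eq_schr (hp : p.Admissible) (m : ℕ) {f : ℝ → ℂ} (hf : DifferentiableOn ℝ f p.dom)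
    {x : ℝ} (hx : x ∈ p.dom) (hf' : DifferentiableAt ℝ (deriv f) x) :
    p.H m f x = p.schr m f x := by
  rcases m with _ | m
  · rfl
  · simp only [H]
    rw [A_Adag_eq hp m hf hx hf', schr, V]
    ring

/-- W_m² - ħW_m' gives back the potential of the same member, by the first Riccati equation. -/
theorem H_eq_Adag_A (hp : p.Admissible) (m : ℕ) {f : ℝ → ℂ} (hf : DifferentiableOn ℝ f p.dom)
    {x : ℝ} (hx : x ∈ p.dom) (hf' : DifferentiableAt ℝ (deriv f) x) :
    p.H m f x = (1 / (2 * p.M : ℂ)) * p.Adag m (p.A m f) x + p.energy m 0 * f x := by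
  have h1 := congrArg (fun r : ℝ => (r : ℂ)) (logSlope_sq_add (b := p.beta) (l := p.nu + m) hp.3
    (by have := hp.nu_nonneg; positivity) hx)
  rw [H_eq_schr hp m hf hx hf', Adag_A_eq hp m hf hx hf', schr, V_eq_pot hp m hx,
    (hasDerivAt_W hp m hx).deriv, W_eq hp m hx, energy_zero_eq hp]
  push_cast at h1 ⊢
  linear_combination -(p.hbar : ℂ) ^ 2 / (2 * p.M) * f x * h1

theorem schr_eq (hp : p.Admissible) (m : ℕ) (f : ℝ → ℂ) {x : ℝ} (hx : x ∈ p.dom) :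
    p.schr m f x = ((p.hbar ^ 2 / (2 * p.M) : ℝ) : ℂ)
      * (pot p.L p.beta (p.nu + m) x * f x - deriv (deriv f) x) := by
  rw [schr, V_eq_pot hp m hx]
  push_cast
  ring

theorem _root_.CotWell.continuousOn_pot {L b l : ℝ} (hL : 0 < L) :
    ContinuousOn (pot L b l) (Ioo 0 L) := by
  have h1 : ContinuousOn (fun x : ℝ => Real.cot (Real.pi * x / L)) (Ioo 0 L) := fun x hx =>
    (hasDerivAt_cot hL hx).continuousAt.continuousWithinAt
  have h2 : ContinuousOn (fun x : ℝ => Real.sin (Real.pi * x / L) ^ 2) (Ioo 0 L) := by fun_prop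
  exact continuousOn_const.mul ((continuousOn_const.div h2 fun x hx =>
    pow_ne_zero 2 (sin_pos hL hx).ne').sub (continuousOn_const.mul h1))

theorem isFiniteMeasure_vol (p : PoschlTeller) : IsFiniteMeasure p.vol :=
  ⟨by rw [vol, dom]; simp⟩

theorem H_eq_of_isSol (hp : p.Admissible) {m : ℕ} {r : ℝ} {f : ℝ → ℂ}
    (hf : IsSol p.L p.beta (p.nu + m) r f) {x : ℝ} (hx : x ∈ p.dom) :
    p.H m f x = ((p.hbar ^ 2 / (2 * p.M) * r : ℝ) : ℂ) * f x := by
  rw [H_eq_schr hp m (fun y hy => (hf.diff y hy).differentiableWithinAt) hx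
    (hf.ode x hx).differentiableAt, schr_eq hp m f hx, (hf.ode x hx).deriv]
  push_cast
  ring

theorem inDomain_of_isSol (hp : p.Admissible) {m : ℕ} {r : ℝ} {f : ℝ → ℂ}
    (hf : IsSol p.L p.beta (p.nu + m) r f) : p.InDomain m f := by
  have hfin := isFiniteMeasure_vol p
  have hmem : MemLp f 2 p.vol := by
    obtain ⟨B, -, hB⟩ := exists_bound hp.3 hf.continuousOn hf.left hf.right
    refine MemLp.of_bound (hf.continuousOn.aestronglyMeasurable measurableSet_Ioo) B ?_
    filter_upwards [ae_restrict_mem measurableSet_Ioo] with x hx using hB x hx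
  refine ⟨hmem, fun y hy => (hf.diff y hy).differentiableWithinAt, ?_, hf.left, hf.right, ?_⟩
  -- The density of f' is f'' as prescribed by the differential equation.
  · refine ⟨fun x => (pot p.L p.beta (p.nu + m) x - (r : ℂ)) * f x, fun a ha b hb => ?_⟩
    have hsub : uIcc a b ⊆ Ioo 0 p.L := ordConnected_Ioo.uIcc_subset ha hb
    have hi : IntervalIntegrable (fun x => (pot p.L p.beta (p.nu + m) x - (r : ℂ)) * f x)
        volume a b := by
      refine ContinuousOn.intervalIntegrable ?_
      exact (((Complex.continuous_ofReal.comp_continuousOn (continuousOn_pot hp.3)).sub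
        continuousOn_const).mul hf.continuousOn).mono hsub
    refine ⟨hi, ?_⟩
    rw [intervalIntegral.integral_eq_sub_of_hasDerivAt (fun x hx => hf.ode x (hsub hx)) hi]
    ring
  · refine (hmem.const_mul ((p.hbar ^ 2 / (2 * p.M) * r : ℝ) : ℂ)).ae_eq ?_
    filter_upwards [ae_restrict_mem measurableSet_Ioo] with x hx
    exact (H_eq_of_isSol hp hf hx).symm

theorem contDiffOn_phi0 (hp : p.Admissible) (n : ℕ) : ContDiffOn ℝ ∞ (p.phi0 n) p.dom := by
  have hsin : ContDiff ℝ ∞ fun x : ℝ => Real.sin (Real.pi * x / p.L) := by fun_prop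
  have hcos : ContDiff ℝ ∞ fun x : ℝ => Real.cos (Real.pi * x / p.L) := by fun_prop
  have hs : ∀ x ∈ p.dom, Real.sin (Real.pi * x / p.L) ≠ 0 := fun x hx => (sin_pos hp.3 hx).ne'
  have hg : ContDiffOn ℝ ∞ (groundState p.L p.beta (p.nu + n)) p.dom :=
    (hsin.contDiffOn.rpow_const_of_ne hs).mul (by fun_prop)
  have hcot : ContDiffOn ℝ ∞ (fun x => Real.cot (Real.pi * x / p.L)) p.dom := by
    simp only [Real.cot_eq_cos_div_sin]
    exact hcos.contDiffOn.div hsin.contDiffOn hs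
  have hv : ContDiffOn ℝ ∞ p.jacobiVar p.dom :=
    ((contDiffOn_const.mul (Complex.ofRealCLM.contDiff.comp_contDiffOn hcot)).sub
      contDiffOn_const).div_const 2
  have hP : ∀ P : Polynomial ℂ, ContDiffOn ℝ ∞ (fun x => P.eval (p.jacobiVar x)) p.dom := by
    intro P
    simp only [Polynomial.eval_eq_sum_range]
    exact ContDiffOn.sum fun k _ => contDiffOn_const.mul (hv.pow k)
  rw [funext (p.phi0_eq n)]
  exact contDiffOn_const.mul ((Complex.ofRealCLM.contDiff.comp_contDiffOn hg).mul (hP _))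

theorem isSol_phi (hp : p.Admissible) (m n : ℕ) :
    IsSol p.L p.beta (p.nu + m) (level p.L p.beta (p.nu + m + n)) (p.phi m n) := by
  obtain ⟨c, -, h⟩ := phi_eq hp m n
  exact ((isSol_phi0 (hp.shift m) n).const_mul hp.3 c).congr hp.3 fun x hx => (h x hx).symm

theorem isNormalizedEigenfunction_phi (hp : p.Admissible) (m n : ℕ) :
    p.IsNormalizedEigenfunction m (p.energy m n) (p.phi m n) := by
  obtain ⟨c, hc, h⟩ := phi_eq hp m n
  have hsol := isSol_phi hp m n
  refine ⟨inDomain_of_isSol hp hsol, ?_, fun x hx => ?_, ?_⟩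
  · exact (contDiffOn_const.mul (contDiffOn_phi0 (hp.shift m) n)).congr h
  · rw [H_eq_of_isSol hp hsol hx, energy_eq, E0_eq_level hp]
    push_cast
    rw [add_assoc p.nu, add_comm (m : ℝ)]
  · have hp' := hp.shift m
    have h1 : CotWell.normSq p.L ((p.shift m).phi0 n) = 1 := normSq_phi0 hp'.3 hp'.4 hp'.5 n
    have h2 : CotWell.normSq p.L (fun x => c * (p.shift m).phi0 n x) = 1 := by
      rw [normSq_const_mul, h1, hc]; norm_num
    rw [← h2]
    refine setIntegral_congr_fun measurableSet_Ioo fun y hy => ?_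
    simp only
    rw [h y hy]

/-- Weak eigenfunctions are classical solutions. -/
theorem isSol_of_inDomain (hp : p.Admissible) {m : ℕ} {e : ℂ} {f : ℝ → ℂ} (hf : p.InDomain m f)
    (he : ∀ᵐ x ∂p.vol, p.H m f x = e * f x) :
    IsSol p.L p.beta (p.nu + m) (2 * p.M / p.hbar ^ 2 * e) f := by
  obtain ⟨-, hd, ⟨g, hg⟩, h0, hL, -⟩ := hf
  have hM : (p.M : ℂ) ≠ 0 := by exact_mod_cast hp.M_pos.ne'
  have hh : (p.hbar : ℂ) ≠ 0 := by exact_mod_cast hp.hbar_pos.ne'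
  refine ⟨fun x hx => hd.differentiableAt (dom_mem_nhds hx), fun x hx => ?_, h0, hL⟩
  set F : ℝ → ℂ := fun x => (pot p.L p.beta (p.nu + m) x - 2 * p.M / p.hbar ^ 2 * e) * f x with hF
  have hFc : ContinuousOn F (Ioo 0 p.L) :=
    ((Complex.continuous_ofReal.comp_continuousOn (continuousOn_pot hp.3)).sub
      continuousOn_const).mul hd.continuousOn
  obtain ⟨a, ha0, hax⟩ := exists_between hx.1
  obtain ⟨b, hxb, hbL⟩ := exists_between hx.2
  have ha : a ∈ p.dom := ⟨ha0, hax.trans hx.2⟩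
  have hb : b ∈ p.dom := ⟨hx.1.trans hxb, hbL⟩
  have hab : a ≤ b := (hax.trans hxb).le
  have hsub : Icc a b ⊆ p.dom := fun y hy => ⟨ha0.trans_le hy.1, hy.2.trans_lt hbL⟩
  have he' : ∀ᵐ y, y ∈ p.dom → p.H m f y = e * f y := by
    rwa [vol, dom, ae_restrict_iff' measurableSet_Ioo] at he
  -- By Lebesgue differentiation f'' exists and equals g almost everywhere, and there the eigenvalue
  -- equation identifies it with the continuous F.
  have hgF : ∀ᵐ y, y ∈ Icc a b → g y = F y := by
    have hne : ∀ c : ℝ, ∀ᵐ y : ℝ, y ≠ c := fun c => by simp [ae_iff, measure_singleton]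
    filter_upwards [(hg a ha b hb).1.ae_hasDerivAt_integral, he', hne a, hne b]
      with y h1 h2 hya hyb hy
    have hy' : y ∈ uIcc a b := by rwa [uIcc_of_le hab]
    have hyd := hsub hy
    have h3 : HasDerivAt (deriv f) (g y) y := by
      refine ((h1 hy' a left_mem_uIcc).const_add (deriv f a)).congr_of_eventuallyEq ?_
      filter_upwards [dom_mem_nhds hyd] with z hz using (hg a ha z hz).2
    have h4 := h2 hyd
    rw [H_eq_schr hp m hd hyd h3.differentiableAt, schr_eq hp m f hyd, h3.deriv] at h4
    simp only [hF]
    push_cast at h4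
    field_simp at h4 ⊢
    linear_combination -h4
  -- With F in place of g, f' is the integral of a continuous function, so the equation holds at
  -- every point.
  have hev : deriv f =ᶠ[𝓝 x] fun y => deriv f a + ∫ t in a..y, F t := by
    filter_upwards [Icc_mem_nhds hax hxb] with y hy
    rw [(hg a ha y (hsub hy)).2]
    congr 1
    refine intervalIntegral.integral_congr_ae ?_
    filter_upwards [hgF] with t ht hty
    rw [uIoc_of_le hy.1] at hty
    exact ht ⟨hty.1.le, hty.2.trans hy.2⟩
  have hint : HasDerivAt (fun y => ∫ t in a..y, F t) (F x) x := by
    refine intervalIntegral.integral_hasDerivAt_right ?_ ?_ (hFc.continuousAt (dom_mem_nhds hx))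
    · refine (hFc.mono ?_).intervalIntegrable
      rw [uIcc_of_le hax.le]
      exact fun y hy => hsub ⟨hy.1, hy.2.trans hxb.le⟩
    · exact hFc.stronglyMeasurableAtFilter isOpen_Ioo x hx
  exact (hint.const_add (deriv f a)).congr_of_eventuallyEq hev

theorem exists_eq_energy (hp : p.Admissible) {m : ℕ} {e : ℂ} {f : ℝ → ℂ} (hf : p.InDomain m f)
    (hne : ∃ x ∈ p.dom, f x ≠ 0) (he : ∀ᵐ x ∂p.vol, p.H m f x = e * f x) :
    ∃ n : ℕ, e = p.energy m n ∧ ∃ c : ℂ, ∀ x ∈ p.dom, f x = c * p.phi m n x := by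
  have hsol := isSol_of_inDomain hp hf he
  have hnu : 0 ≤ p.nu + m := (hp.shift m).nu_nonneg
  obtain ⟨n, hn⟩ := hsol.exists_level hp.3 hnu hne
  refine ⟨n, ?_, ?_⟩
  · have hM : (p.M : ℂ) ≠ 0 := by exact_mod_cast hp.M_pos.ne'
    have hh : (p.hbar : ℂ) ≠ 0 := by exact_mod_cast hp.hbar_pos.ne'
    rw [energy_eq, E0_eq_level hp, Complex.ofReal_mul,
      show p.nu + ((n + m : ℕ) : ℝ) = p.nu + m + n by push_cast; ring, ← hn]
    push_cast
    field_simp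
  · rw [hn] at hsol
    refine IsSol.exists_eq_const_mul hp.3 n hnu (isSol_phi hp m n) hsol ?_
    obtain ⟨c, hc, h⟩ := phi_eq hp m n
    obtain ⟨x, hx, hne⟩ := exists_phi0_ne_zero (hp.shift m) n
    refine ⟨x, hx, ?_⟩
    rw [h x hx]
    exact mul_ne_zero (by rintro rfl; simp at hc) hne

/-! ### The closed form of φ_n^{(1)} -/

theorem meanGap_pos (hp : p.Admissible) (n : ℕ) : 0 < p.meanGap n := by
  have := E0_lt hp n.succ_pos
  exact div_pos (sub_pos.mpr this) (by positivity)

/-- Both the quadratic and the β² part of E_{n+1} - E_0 contain (ν+n+2)² - (ν+1)² = (n+1)(n+2ν+3);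
the remaining factor is 1 + tan² α_n. -/
theorem meanGap_eq (hp : p.Admissible) (n : ℕ) :
    2 * p.M * p.meanGap n = (p.hbar * (Real.pi / p.L)) ^ 2 * (n + 2 * p.nu + 3)
      * (1 + (p.beta / ((p.nu + 1) * (p.nu + n + 2))) ^ 2) := by
  have := hp.M_pos.ne'
  have := hp.L_pos.ne'
  have h1 : p.nu + 1 ≠ 0 := by have := hp.nu_nonneg; positivity
  have h2 : p.nu + n + 2 ≠ 0 := by have := hp.nu_nonneg; positivity
  have h3 : (n : ℝ) + 1 ≠ 0 := by positivity
  have h4 : (n : ℝ) + 1 + p.nu + 1 ≠ 0 := by have := hp.nu_nonneg; positivity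
  rw [meanGap, E0, E0, eps0]
  push_cast
  rw [show (n : ℝ) + 1 + p.nu + 1 = p.nu + n + 2 by ring, zero_add]
  field_simp
  ring

theorem cos_sub_alpha (p : PoschlTeller) (n : ℕ) (t : ℝ) :
    Real.sqrt (1 + (p.beta / ((p.nu + 1) * (p.nu + n + 2))) ^ 2) * Real.cos (t - p.alpha n)
      = Real.cos t + p.beta / ((p.nu + 1) * (p.nu + n + 2)) * Real.sin t := by
  rw [Real.cos_sub, alpha, Real.cos_arctan, Real.sin_arctan]
  have h : Real.sqrt (1 + (p.beta / ((p.nu + 1) * (p.nu + n + 2))) ^ 2) ≠ 0 :=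
    (Real.sqrt_pos.mpr (by positivity)).ne'
  field_simp

theorem sqrt_meanGap (hp : p.Admissible) (n : ℕ) :
    Real.sqrt (2 * p.M * (n + 1) ^ 2 * p.meanGap n / (n + 2 * p.nu + 3))
      = p.hbar * (Real.pi / p.L) * (n + 1)
        * Real.sqrt (1 + (p.beta / ((p.nu + 1) * (p.nu + n + 2))) ^ 2) := by
  have hn : (n : ℝ) + 2 * p.nu + 3 ≠ 0 := by have := hp.nu_nonneg; positivity
  have h1 : 2 * p.M * (n + 1) ^ 2 * p.meanGap n / (n + 2 * p.nu + 3)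
      = (p.hbar * (Real.pi / p.L) * (n + 1)) ^ 2
        * (1 + (p.beta / ((p.nu + 1) * (p.nu + n + 2))) ^ 2) := by
    rw [div_eq_iff hn]
    linear_combination ((n : ℝ) + 1) ^ 2 * meanGap_eq hp n
  have := hp.hbar_pos
  have := hp.L_pos
  have := Real.pi_pos
  rw [h1, Real.sqrt_mul (by positivity), Real.sqrt_sq (by positivity)]

theorem Kn_div_sqrt (hp : p.Admissible) (n : ℕ) :
    p.Kn (n + 1) / Real.sqrt (2 * p.M * (p.E0 (n + 1) - p.E0 0))
      = (2 : ℝ) ^ ((n : ℝ) + p.nu + 2) * Real.exp (p.beta * Real.pi / (2 * (n + p.nu + 2)))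
      * p.bigT (n + 1)
      / Real.sqrt (2 * p.M * p.L * (n + 1) * (p.bigO (n + 1)).re * p.meanGap n) := by
  have hO := bigO_re_pos hp.3 hp.4 hp.5 (n + 1)
  have hE : p.E0 (n + 1) - p.E0 0 = (n + 1) * p.meanGap n := by
    rw [meanGap]; field_simp
  have e : 2 * p.M * p.L * (n + 1) * (p.bigO (n + 1)).re * p.meanGap n
      = p.L * ((p.bigO (n + 1)).re * (2 * p.M * ((n + 1) * p.meanGap n))) := by ring
  rw [e, Real.sqrt_mul hp.3.le, Real.sqrt_mul hO.le, hE, Kn]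
  push_cast
  rw [show (n : ℝ) + 1 + p.nu + 1 = n + p.nu + 2 by ring]
  simp only [div_eq_mul_inv, mul_inv]
  ring

/-- Apart from constants, A_0 φ_{n+1} is the sum of (u_{ν+n+1} - u_ν) gP and g w' P'. The difference
of slopes is a multiple of cos(πx/L - α_n)/sin(πx/L), the derivative formula turns P' into the
second Jacobi polynomial, and one factor sin of g is used up. -/
theorem phi_one_eq (hp : p.Admissible) (n : ℕ) {x : ℝ} (hx : x ∈ p.dom) :
    p.phi 1 n x = p.phi1Explicit n x := by
  have hs := sin_pos hp.3 hx
  have hsc : (Real.sin (Real.pi * x / p.L) : ℂ) ≠ 0 := by exact_mod_cast hs.ne'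
  have hnu := hp.nu_nonneg
  set a := p.an (n + 1) with ha
  have hder := (hasDerivAt_psi hp.3 (n + 1) hx).const_mul (p.Kn (n + 1) : ℂ)
  rw [← funext (p.phi0_eq (n + 1))] at hder
  have e1 : (n : ℂ) + a + starRingEnd ℂ a + 2 = -(n + 2 * p.nu + 2) := by
    rw [ha, conj_an, an]; push_cast; ring
  rw [derivative_jacobiPoly_succ, Polynomial.eval_mul, Polynomial.eval_C, ← ha, e1] at hder
  have h1 : p.phi 1 n x = p.A 0 (p.phi0 (n + 1)) x
      / (Real.sqrt (2 * p.M * (p.E0 (n + 1) - p.E0 0)) : ℝ) := phi_succ_eq hp 0 n x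
  have hsl : logSlope p.L p.beta (p.nu + ((n + 1 : ℕ) : ℝ)) x - logSlope p.L p.beta p.nu x
      = Real.pi / p.L * (n + 1) * (Real.sqrt (1 + (p.beta / ((p.nu + 1) * (p.nu + n + 2))) ^ 2)
        * Real.cos (Real.pi * x / p.L - p.alpha n)) / Real.sin (Real.pi * x / p.L) := by
    have h2 : p.nu + 1 ≠ 0 := by positivity
    have h3 : p.nu + n + 2 ≠ 0 := by positivity
    rw [cos_sub_alpha, logSlope, logSlope, Real.cot_eq_cos_div_sin]
    push_cast
    rw [show p.nu + ((n : ℝ) + 1) + 1 = p.nu + n + 2 by ring]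
    have := hp.L_pos.ne'
    field_simp
    ring
  have hslc := congrArg (fun r : ℝ => (r : ℂ)) hsl
  have hg : groundState p.L p.beta (p.nu + ((n + 1 : ℕ) : ℝ)) x
      = Real.sin (Real.pi * x / p.L) * (Real.sin (Real.pi * x / p.L) ^ (p.nu + n + 1)
      * Real.exp (-(p.beta * Real.pi * x / (p.L * (p.nu + n + 2))))) := by
    rw [groundState_eq hp.3 hx]
    push_cast
    rw [show p.nu + ((n : ℝ) + 1) + 1 = p.nu + n + 2 by ring,
      show p.nu + ((n : ℝ) + 1) = p.nu + n + 1 by ring]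
    ring
  have hK := congrArg (fun r : ℝ => (r : ℂ)) (Kn_div_sqrt hp n)
  simp only [Complex.ofReal_div (p.Kn (n + 1))] at hK
  rw [h1, A_eq hp 0 _ hx, Nat.cast_zero, add_zero, phi1Explicit, ← hK, lowerOp, hder.deriv, phi0_eq,
    sqrt_meanGap hp, psi, ← ha, hg, jacobiP_eq_eval, jacobiP_eq_eval, ← jacobiVar]
  generalize (jacobiPoly (n + 1) a (starRingEnd ℂ a)).eval (p.jacobiVar x) = Q
  generalize (jacobiPoly n (a + 1) (starRingEnd ℂ a + 1)).eval (p.jacobiVar x) = Q1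
  generalize Real.sin (Real.pi * x / p.L) ^ (p.nu + n + 1)
      * Real.exp (-(p.beta * Real.pi * x / (p.L * (p.nu + n + 2)))) = G
  generalize Real.sqrt (2 * p.M * (p.E0 (n + 1) - p.E0 0)) = R
  generalize Real.sqrt (1 + (p.beta / ((p.nu + 1) * (p.nu + n + 2))) ^ 2) = r at hslc ⊢
  generalize Real.cos (Real.pi * x / p.L - p.alpha n) = C at hslc ⊢
  generalize Real.sin (Real.pi * x / p.L) = S at hsc hslc ⊢
  generalize logSlope p.L p.beta (p.nu + ((n + 1 : ℕ) : ℝ)) x = σ1 at hslc ⊢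
  generalize logSlope p.L p.beta p.nu x = σ0 at hslc ⊢
  have hσ : (σ1 : ℂ) = σ0 + Real.pi / p.L * (n + 1) * (r * C) / S := by
    push_cast at hslc
    linear_combination hslc
  rw [hσ]
  push_cast
  have hLc : (p.L : ℂ) ≠ 0 := by exact_mod_cast hp.L_pos.ne'
  field_simp
  ring

end PoschlTeller

end

theorem proposition1 (p : PoschlTeller) (h_hbar : 0 < p.hbar) (h_M : 0 < p.M) (h_L : 0 < p.L)
    (h_nu : 0 ≤ p.nu) (h_beta : 0 ≤ p.beta) :
    -- the functions `φ_n` are normalized eigenfunctions of `H_{ν,β}`, with eigenvalues `E_n`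
    (∀ n : ℕ, (p.bigO n).im = 0 ∧ 0 < (p.bigO n).re ∧
      p.IsNormalizedEigenfunction 0 (p.E0 n) (p.phi0 n)) ∧
    -- the hierarchy is well defined: every `φ_0^{(m)}` is free of zeros, and
    -- `H^{(m)} = (1/2M) A_m† A_m + E_0^{(m)} = -(ħ²/2M) d²/dx² + V_m`
    (∀ m : ℕ, (∀ x ∈ p.dom, p.phi m 0 x ≠ 0) ∧
      ∀ f : ℝ → ℂ, DifferentiableOn ℝ f p.dom → ∀ x ∈ p.dom, DifferentiableAt ℝ (deriv f) x →
        p.H m f x = p.schr m f x ∧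
        p.H m f x = (1 / (2 * p.M : ℂ)) * p.Adag m (p.A m f) x + p.energy m 0 * f x) ∧
    -- eigenvalues and eigenfunctions of `H^{(m+1)}`
    (∀ m n : ℕ,
      p.IsNormalizedEigenfunction (m + 1) (p.energy (m + 1) n) (p.phi (m + 1) n) ∧
      p.energy (m + 1) n = p.eps0 * ((n + m + p.nu + 2) ^ 2
        - p.beta ^ 2 / (n + m + p.nu + 2) ^ 2) ∧
      (∀ k ≤ m, p.E0 k < p.E0 (n + m + 1)) ∧
      ∀ x ∈ p.dom, p.phi (m + 1) n x = p.B m (p.phi0 (n + m + 1)) x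
        / (Real.sqrt ((2 * p.M) ^ (m + 1)
            * ∏ k ∈ Finset.range (m + 1), (p.E0 (n + m + 1) - p.E0 k)) : ℝ)) ∧
    -- there are no others, and each eigenvalue is simple
    (∀ (m : ℕ) (e : ℂ) (f : ℝ → ℂ), p.InDomain (m + 1) f → (∃ x ∈ p.dom, f x ≠ 0) →
      (∀ᵐ x ∂p.vol, p.H (m + 1) f x = e * f x) →
      ∃ n : ℕ, e = p.energy (m + 1) n ∧ ∃ c : ℂ, ∀ x ∈ p.dom, f x = c * p.phi (m + 1) n x) ∧
    -- the case `m = 0`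
    (∀ n : ℕ, p.energy 1 n = p.eps0 * ((n + p.nu + 2) ^ 2 - p.beta ^ 2 / (n + p.nu + 2) ^ 2)) ∧
    (∀ n : ℕ, 0 < p.meanGap n ∧ ∀ x ∈ p.dom, p.phi 1 n x = p.phi1Explicit n x) ∧
    (∀ x ∈ p.dom, p.W 1 x = ((-(p.hbar * Real.pi / p.L)
      * ((p.nu + 2) * Real.cot (Real.pi * x / p.L) - p.beta / (p.nu + 2)) : ℝ) : ℂ)) ∧
    (∀ x ∈ p.dom, p.V 1 x = ((p.eps0 * ((p.nu + 1) * (p.nu + 2)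
      / Real.sin (Real.pi * x / p.L) ^ 2
        - 2 * p.beta * Real.cot (Real.pi * x / p.L)) : ℝ) : ℂ)) := by
  have hp : p.Admissible := ⟨h_hbar, h_M, h_L, h_nu, h_beta⟩
  have henergy : ∀ m n : ℕ, p.energy (m + 1) n = p.eps0 * ((n + m + p.nu + 2) ^ 2
      - p.beta ^ 2 / (n + m + p.nu + 2) ^ 2) := by
    intro m n
    rw [PoschlTeller.energy_eq, PoschlTeller.E0]
    push_cast
    rw [show (n : ℝ) + (m + 1) + p.nu + 1 = n + m + p.nu + 2 by ring]
  refine ⟨fun n => ⟨PoschlTeller.bigO_im h_L h_nu n, PoschlTeller.bigO_re_pos h_L h_nu h_beta n,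
    -- For m = 0, `energy` and `phi` unfold to `E0` and `phi0`.
    PoschlTeller.isNormalizedEigenfunction_phi hp 0 n⟩,
    fun m => ⟨fun x hx => PoschlTeller.phi_ne_zero hp m hx, fun f hf x hx hf' =>
      ⟨PoschlTeller.H_eq_schr hp m hf hx hf', PoschlTeller.H_eq_Adag_A hp m hf hx hf'⟩⟩,
    fun m n => ⟨PoschlTeller.isNormalizedEigenfunction_phi hp (m + 1) n, henergy m n,
      fun k hk => PoschlTeller.E0_lt hp (by omega), PoschlTeller.phi_succ_eq_B hp m n⟩,
    fun m e f hf hne he => PoschlTeller.exists_eq_energy hp hf hne he, fun n => ?_,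
    fun n => ⟨PoschlTeller.meanGap_pos hp n, fun x hx => PoschlTeller.phi_one_eq hp n hx⟩,
    fun x hx => ?_, fun x hx => ?_⟩
  · have h := henergy 0 n
    rwa [Nat.cast_zero, add_zero] at h
  · rw [PoschlTeller.W_eq hp 1 hx, CotWell.logSlope, Nat.cast_one,
      show p.nu + 1 + 1 = p.nu + 2 by ring]
    congr 1
    ring
  · rw [PoschlTeller.V_eq_pot hp 1 hx, CotWell.pot, PoschlTeller.eps0, Nat.cast_one,
      show p.nu + 1 + 1 = p.nu + 2 by ring]
    congr 1
    field_simp
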